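/- Let $H$ be the hyperbolic space of dimension $n+1$ and constant sectional curvature $-1$. Let $\mathcal L$ be the space of all complete oriented geodesics of $H$ (unit speed geodesics $\gamma:\mathbb R\to H$ up to orientation preserving reparametrization; the class of $\gamma$ is denoted $[\gamma]$), with its canonical differentiable structure of dimension $2n$: the one for which $[\gamma]\mapsto(\gamma(-\infty),\gamma(\infty))$ is a diffeomorphism onto $\{(p,q)\in S^n\times S^n: p\ne q\}$. Let $g$ be the canonical split semi-Riemannian metric on $\mathcal L$ (induced by the Killing form of the isometry group of $H$), whose square norm is $$\|X\|=\langle J,J\rangle-\langle J',J'\rangle\quad\text{for } X=\tfrac{d}{dt}\big|_{0}[\gamma_t]\in T_{[\gamma]}\mathcal L ,$$ where $\gamma_t$ is a smooth variation of $\gamma_0=\gamma$ by unit speed geodesics whose variation field $J$ is orthogonal to $\gamma'$ and $J'$ is the covariant derivative of $J$ along $\gamma$ (the right-hand side is constant along $\gamma$ and depends only on $X$). For $v$ a unit tangent vector of $H$, $\gamma_v$ denotes the geodesic with initial velocity $v$. Let $S$ be a connected, complete, totally geodesic submanifold of $H$ of codimension one, and let $V$ be a smooth unit vector field normal to $S$.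 Then $$\phi:S\to\mathcal L,\qquad \phi(q)=[\gamma_{V(q)}],$$ is a smooth embedding (a smooth map with injective differentials which is a homeomorphism onto its image), and it is space-like: $\|d\phi_q(w)\|>0$ for all $q\in S$ and all nonzero $w\in T_qS$. Moreover $\|d\phi_q(w)\|=\langle w,w\rangle$ for all $q\in S$ and $w\in T_qS$. -/

import Mathlib

open scoped ContDiff Manifold


namespace HypLines

noncomputable section

/-- Minkowski space `ℝ^{1,n+1}`: time coordinate first. -/
abbrev Mink (n : ℕ) : Type := ℝ × EuclideanSpace ℝ (Fin (n + 1))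

/-- The Lorentzian inner product. -/
def mink {n : ℕ} (x y : Mink n) : ℝ := inner ℝ x.2 y.2 - x.1 * y.1

/-- Hyperbolic space of dimension `n + 1` and constant curvature `-1` (hyperboloid model).
Its tangent space at `x` is `{u | mink x u = 0}`, its Riemannian metric is the restriction of
`mink`. -/
def hyperboloid (n : ℕ) : Set (Mink n) := {x | mink x x = -1 ∧ 0 < x.1}

/-- The Levi-Civita covariant derivative in hyperbolic space of a vector field `X` along a curve
`c`: the component of the ambient derivative tangent to the hyperboloid at `c t`. -/
def covDeriv {n : ℕ} (c X : ℝ → Mink n) (t : ℝ) : Mink n :=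
  deriv X t + mink (deriv X t) (c t) • c t

/-- Complete geodesics of hyperbolic space parametrized by arc length. -/
structure UnitGeodesic (n : ℕ) where
  /-- the underlying curve -/
  toFun : ℝ → Mink n
  smooth : ContDiff ℝ ∞ toFun
  mem_hyperboloid : ∀ t, toFun t ∈ hyperboloid n
  unit_speed : ∀ t, mink (deriv toFun t) (deriv toFun t) = 1
  geodesic : ∀ t, covDeriv toFun (deriv toFun) t = 0

/-- Two unit speed geodesics are the same oriented geodesic if they differ by an
orientation preserving reparametrization, that is, by a translation of the parameter. -/
def sameLine {n : ℕ} : Setoid (UnitGeodesic n) where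
  r γ₁ γ₂ := ∃ c : ℝ, ∀ t, γ₂.toFun t = γ₁.toFun (t + c)
  iseqv :=
    { refl := fun _ => ⟨0, fun t => by rw [add_zero]⟩
      symm := fun ⟨c, h⟩ => ⟨-c, fun t => by rw [h, neg_add_cancel_right]⟩
      trans := fun ⟨c, h⟩ ⟨d, k⟩ => ⟨d + c, fun t => by rw [k, h, add_assoc]⟩ }

/-- The space of complete oriented geodesics of hyperbolic space. -/
def OrientedGeodesic (n : ℕ) : Type := Quotient (sameLine (n := n))

/-- The oriented geodesic of a unit speed geodesic. -/
def UnitGeodesic.line {n : ℕ} (γ : UnitGeodesic n) : OrientedGeodesic n := Quotient.mk _ γ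

/-! ### Elementary facts on the Lorentzian product -/

section Algebra
variable {n : ℕ}

lemma mink_comm (x y : Mink n) : mink x y = mink y x := by
  simp only [mink, real_inner_comm, mul_comm]
lemma mink_add_left (x y z : Mink n) : mink (x + y) z = mink x z + mink y z := by
  simp only [mink, Prod.fst_add, Prod.snd_add, inner_add_left]; ring
lemma mink_smul_left (a : ℝ) (x z : Mink n) : mink (a • x) z = a * mink x z := by
  simp only [mink, Prod.smul_fst, Prod.smul_snd, real_inner_smul_left, smul_eq_mul]; ring
lemma mink_add_right (x y z : Mink n) : mink x (y + z) = mink x y + mink x z := by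
  rw [mink_comm, mink_add_left, mink_comm y, mink_comm z]
lemma mink_smul_right (a : ℝ) (x z : Mink n) : mink x (a • z) = a * mink x z := by
  rw [mink_comm, mink_smul_left, mink_comm]
lemma mink_sub_left (x y z : Mink n) : mink (x - y) z = mink x z - mink y z := by
  simp only [mink, Prod.fst_sub, Prod.snd_sub, inner_sub_left]; ring
lemma mink_sub_right (x y z : Mink n) : mink x (y - z) = mink x y - mink x z := by
  rw [mink_comm, mink_sub_left, mink_comm y, mink_comm z]

lemma hasDerivAt_mink {f g : ℝ → Mink n} {f' g' : Mink n} {t : ℝ}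
    (hf : HasDerivAt f f' t) (hg : HasDerivAt g g' t) :
    HasDerivAt (fun s => mink (f s) (g s)) (mink (f t) g' + mink f' (g t)) t := by
  have f1 : HasDerivAt (fun s => (f s).1) f'.1 t := by
    have := hf.hasFDerivAt.fst.hasDerivAt; simpa using this
  have f2 : HasDerivAt (fun s => (f s).2) f'.2 t := by
    have := hf.hasFDerivAt.snd.hasDerivAt; simpa using this
  have g1 : HasDerivAt (fun s => (g s).1) g'.1 t := by
    have := hg.hasFDerivAt.fst.hasDerivAt; simpa using this
  have g2 : HasDerivAt (fun s => (g s).2) g'.2 t := by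
    have := hg.hasFDerivAt.snd.hasDerivAt; simpa using this
  have h1 := (HasDerivAt.inner ℝ f2 g2).sub (f1.mul g1)
  exact h1.congr_deriv (by simp only [mink]; ring)

/-- A null vector paired negatively with a future pointing null vector is future pointing. -/
lemma null_pos_of_pos {u w : Mink n} (hu : mink u u = 0) (hw : mink w w = 0)
    (huw : mink u w < 0) (hw1 : 0 < w.1) : 0 < u.1 := by
  by_contra hneg
  push Not at hneg
  simp only [mink, real_inner_self_eq_norm_sq] at hu hw huw
  have h1 : ‖u.2‖ = -u.1 := by
    apply (sq_eq_sq₀ (norm_nonneg _) (by linarith)).1; nlinarith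
  have h2 : ‖w.2‖ = w.1 := by
    apply (sq_eq_sq₀ (norm_nonneg _) hw1.le).1; nlinarith
  have h3 := neg_le_of_abs_le (abs_real_inner_le_norm u.2 w.2)
  rw [h1, h2] at h3
  linarith

lemma null_pos {u w : Mink n} (hu : mink u u = 0) (hw : mink w w = 0) (huw : mink u w < 0)
    (h : 0 < u.1 + w.1) : 0 < u.1 := by
  by_contra hneg
  exact hneg (null_pos_of_pos hu hw huw (by linarith))

end Algebra

/-! ### Unit speed geodesics -/

namespace UnitGeodesic
variable {n : ℕ}

@[ext] lemma ext {γ δ : UnitGeodesic n} (h : ∀ t, γ.toFun t = δ.toFun t) : γ = δ := by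
  cases γ; cases δ; congr; exact funext h

lemma differentiable (γ : UnitGeodesic n) : Differentiable ℝ γ.toFun :=
  γ.smooth.differentiable (by simp)

lemma differentiable_deriv (γ : UnitGeodesic n) : Differentiable ℝ (deriv γ.toFun) :=
  ((γ.smooth.of_le (by norm_cast) : ContDiff ℝ (1 + 1) γ.toFun).deriv').differentiable
    (by simp)

lemma mink_deriv (γ : UnitGeodesic n) (t : ℝ) : mink (γ.toFun t) (deriv γ.toFun t) = 0 := by
  have h := hasDerivAt_mink (γ.differentiable t).hasDerivAt (γ.differentiable t).hasDerivAt
  have h2 : (fun s => mink (γ.toFun s) (γ.toFun s)) = fun _ => (-1 : ℝ) :=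
    funext fun s => (γ.mem_hyperboloid s).1
  rw [h2] at h
  have := h.unique (hasDerivAt_const t (-1 : ℝ))
  rw [mink_comm (deriv _ _)] at this
  linarith

lemma deriv_deriv (γ : UnitGeodesic n) (t : ℝ) : deriv (deriv γ.toFun) t = γ.toFun t := by
  have h := hasDerivAt_mink (γ.differentiable t).hasDerivAt (γ.differentiable_deriv t).hasDerivAt
  rw [show (fun s => mink (γ.toFun s) (deriv γ.toFun s)) = fun _ => (0 : ℝ) from
    funext γ.mink_deriv] at h
  have h1 := h.unique (hasDerivAt_const t (0 : ℝ))
  rw [γ.unit_speed, mink_comm] at h1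
  have h2 := γ.geodesic t
  rw [covDeriv, show mink (deriv (deriv γ.toFun) t) (γ.toFun t) = -1 by linarith] at h2
  rw [neg_one_smul, ← sub_eq_add_neg] at h2
  exact sub_eq_zero.1 h2

lemma eq_cosh_sinh (γ : UnitGeodesic n) (t : ℝ) :
    γ.toFun t = Real.cosh t • γ.toFun 0 + Real.sinh t • deriv γ.toFun 0 := by
  have hd := fun s => (γ.differentiable s).hasDerivAt
  have hdd : ∀ s, HasDerivAt (deriv γ.toFun) (γ.toFun s) s := fun s => by
    simpa [γ.deriv_deriv s] using (γ.differentiable_deriv s).hasDerivAt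
  have hc := fun s => Real.hasDerivAt_cosh s
  have hs := fun s => Real.hasDerivAt_sinh s
  have key : ∀ s, HasDerivAt (fun s => Real.cosh s • γ.toFun s - Real.sinh s • deriv γ.toFun s)
      0 s := fun s => by
    have := ((hc s).smul (hd s)).sub ((hs s).smul (hdd s))
    exact this.congr_deriv (by module)
  have key2 : ∀ s, HasDerivAt (fun s => Real.cosh s • deriv γ.toFun s - Real.sinh s • γ.toFun s)
      0 s := fun s => by
    have := ((hc s).smul (hdd s)).sub ((hs s).smul (hd s))
    exact this.congr_deriv (by module)
  have e1 := is_const_of_deriv_eq_zero (fun s => (key s).differentiableAt)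
    (fun s => (key s).deriv) t 0
  have e2 := is_const_of_deriv_eq_zero (fun s => (key2 s).differentiableAt)
    (fun s => (key2 s).deriv) t 0
  simp only [Real.cosh_zero, Real.sinh_zero, one_smul, zero_smul, sub_zero] at e1 e2
  rw [← e1, ← e2]
  have h0 : Real.cosh t ^ 2 - Real.sinh t ^ 2 = 1 := by rw [Real.cosh_sq]; ring
  calc γ.toFun t = (Real.cosh t ^ 2 - Real.sinh t ^ 2) • γ.toFun t := by rw [h0, one_smul]
    _ = _ := by module

end UnitGeodesic

/-- Unit tangent vectors of hyperbolic space: `vec` is a unit vector tangent at `pt`. -/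
@[ext] structure UnitTangent (n : ℕ) where
  /-- the base point -/
  pt : Mink n
  /-- the vector -/
  vec : Mink n
  pt_mem : pt ∈ hyperboloid n
  tangent : mink pt vec = 0
  unit : mink vec vec = 1

namespace UnitTangent
variable {n : ℕ}

/-- forward null vector -/
def fwd (v : UnitTangent n) : Mink n := v.pt + v.vec
/-- backward null vector -/
def bwd (v : UnitTangent n) : Mink n := v.pt - v.vec

lemma fwd_fwd (v : UnitTangent n) : mink v.fwd v.fwd = 0 := by
  have h := v.pt_mem.1
  simp only [fwd, mink_add_left, mink_add_right, mink_comm v.vec v.pt, v.tangent, v.unit, h]; ring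
lemma bwd_bwd (v : UnitTangent n) : mink v.bwd v.bwd = 0 := by
  have h := v.pt_mem.1
  simp only [bwd, mink_sub_left, mink_sub_right, mink_comm v.vec v.pt, v.tangent, v.unit, h]; ring
lemma fwd_bwd (v : UnitTangent n) : mink v.fwd v.bwd = -2 := by
  have h := v.pt_mem.1
  simp only [fwd, bwd, mink_add_left, mink_sub_right, mink_comm v.vec v.pt, v.tangent, v.unit, h]
  ring
lemma fwd_add_bwd (v : UnitTangent n) : v.fwd.1 + v.bwd.1 = 2 * v.pt.1 := by
  simp only [fwd, bwd, Prod.fst_add, Prod.fst_sub]; ring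
lemma fwd_pos (v : UnitTangent n) : 0 < v.fwd.1 :=
  null_pos v.fwd_fwd v.bwd_bwd (by rw [v.fwd_bwd]; norm_num)
    (by rw [v.fwd_add_bwd]; have := v.pt_mem.2; linarith)
lemma bwd_pos (v : UnitTangent n) : 0 < v.bwd.1 :=
  null_pos v.bwd_bwd v.fwd_fwd (by rw [mink_comm, v.fwd_bwd]; norm_num)
    (by rw [add_comm, v.fwd_add_bwd]; have := v.pt_mem.2; linarith)

/-- A unit tangent vector from two null vectors. -/
def ofNull (u w : Mink n) (hu : mink u u = 0) (hw : mink w w = 0) (huw : mink u w = -2)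
    (h : 0 < u.1 + w.1) : UnitTangent n where
  pt := (1 / 2 : ℝ) • (u + w)
  vec := (1 / 2 : ℝ) • (u - w)
  pt_mem := by
    refine ⟨?_, ?_⟩
    · simp only [mink_smul_left, mink_smul_right, mink_add_left, mink_add_right, hu, hw, huw,
        mink_comm w u]; ring
    · simp only [Prod.smul_fst, Prod.fst_add, smul_eq_mul]; linarith
  tangent := by
    simp only [mink_smul_left, mink_smul_right, mink_add_left, mink_sub_right, hu, hw, huw,
        mink_comm w u]; ring
  unit := by
    simp only [mink_smul_left, mink_smul_right, mink_sub_left, mink_sub_right, hu, hw, huw,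
        mink_comm w u]; ring

lemma deriv_cosh_sinh (p v : Mink n) (t : ℝ) :
    HasDerivAt (fun t => Real.cosh t • p + Real.sinh t • v)
      (Real.cosh t • v + Real.sinh t • p) t := by
  have := ((Real.hasDerivAt_cosh t).smul_const p).add ((Real.hasDerivAt_sinh t).smul_const v)
  rwa [add_comm (Real.sinh t • p)] at this

/-- The point at time `t` of the geodesic with initial velocity `v`, together with the velocity. -/
def flow (v : UnitTangent n) (t : ℝ) : UnitTangent n :=
  ofNull (Real.exp t • v.fwd) (Real.exp (-t) • v.bwd)
    (by simp [mink_smul_left, mink_smul_right, v.fwd_fwd])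
    (by simp [mink_smul_left, mink_smul_right, v.bwd_bwd])
    (by simp only [mink_smul_left, mink_smul_right, v.fwd_bwd]
        rw [← mul_assoc, ← Real.exp_add]; simp)
    (by have h1 := v.fwd_pos
        have h2 := v.bwd_pos
        have := Real.exp_pos t
        have := Real.exp_pos (-t)
        simp only [Prod.smul_fst, smul_eq_mul]; positivity)

lemma flow_pt (v : UnitTangent n) (t : ℝ) :
    (v.flow t).pt = Real.cosh t • v.pt + Real.sinh t • v.vec := by
  simp only [flow, ofNull, fwd, bwd, Real.cosh_eq, Real.sinh_eq]; module

lemma flow_vec (v : UnitTangent n) (t : ℝ) :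
    (v.flow t).vec = Real.cosh t • v.vec + Real.sinh t • v.pt := by
  simp only [flow, ofNull, fwd, bwd, Real.cosh_eq, Real.sinh_eq]; module

/-- The geodesic `γ_v` with initial velocity `v`. -/
def geodesic (v : UnitTangent n) : UnitGeodesic n where
  toFun t := Real.cosh t • v.pt + Real.sinh t • v.vec
  smooth := (Real.contDiff_cosh.smul contDiff_const).add (Real.contDiff_sinh.smul contDiff_const)
  mem_hyperboloid t := by rw [← flow_pt]; exact (v.flow t).pt_mem
  unit_speed t := by
    rw [(deriv_cosh_sinh v.pt v.vec t).deriv, ← flow_vec]; exact (v.flow t).unit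
  geodesic t := by
    have h : deriv (fun t => Real.cosh t • v.pt + Real.sinh t • v.vec) =
        fun t => Real.cosh t • v.vec + Real.sinh t • v.pt :=
      funext fun t => (deriv_cosh_sinh v.pt v.vec t).deriv
    rw [covDeriv, h, (deriv_cosh_sinh v.vec v.pt t).deriv, ← flow_pt, (v.flow t).pt_mem.1]
    simp

lemma geodesic_zero (v : UnitTangent n) : v.geodesic.toFun 0 = v.pt := by simp [geodesic]
lemma deriv_geodesic (v : UnitTangent n) (t : ℝ) :
    deriv v.geodesic.toFun t = Real.cosh t • v.vec + Real.sinh t • v.pt :=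
  (deriv_cosh_sinh v.pt v.vec t).deriv

end UnitTangent

namespace UnitGeodesic
variable {n : ℕ}

/-- The velocity of a unit speed geodesic at time `t`. -/
def velocity (γ : UnitGeodesic n) (t : ℝ) : UnitTangent n :=
  ⟨γ.toFun t, deriv γ.toFun t, γ.mem_hyperboloid t, γ.mink_deriv t, γ.unit_speed t⟩

/-- A geodesic is determined by its initial velocity. -/
lemma eq_geodesic (γ : UnitGeodesic n) : γ = (γ.velocity 0).geodesic :=
  ext fun t => γ.eq_cosh_sinh t

end UnitGeodesic

/-! ### The space of oriented geodesics as a manifold -/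

/-- The sphere at infinity. -/
abbrev SphereInf (n : ℕ) : Type := Metric.sphere (0 : EuclideanSpace ℝ (Fin (n + 1))) 1

section Endpoints
variable {n : ℕ}

/-- The point at infinity represented by a future pointing null vector. -/
def ray (u : Mink n) : EuclideanSpace ℝ (Fin (n + 1)) := u.1⁻¹ • u.2

lemma ray_smul {a : ℝ} (ha : a ≠ 0) (u : Mink n) : ray (a • u) = ray u := by
  simp only [ray, Prod.smul_fst, Prod.smul_snd, smul_eq_mul, smul_smul]
  congr 1; field_simp

lemma ray_mem {u : Mink n} (hu : mink u u = 0) (h : 0 < u.1) :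
    ray u ∈ Metric.sphere (0 : EuclideanSpace ℝ (Fin (n + 1))) 1 := by
  simp only [mink, real_inner_self_eq_norm_sq] at hu
  have h1 : ‖u.2‖ = u.1 := by
    apply (sq_eq_sq₀ (norm_nonneg _) h.le).1; nlinarith
  rw [mem_sphere_zero_iff_norm, ray, norm_smul, h1, norm_inv, Real.norm_of_nonneg h.le,
    inv_mul_cancel₀ h.ne']

lemma eq_smul_ray {u : Mink n} (h : 0 < u.1) : u = u.1 • ((1 : ℝ), ray u) := by
  ext1
  · simp
  · simp [ray, smul_smul, h.ne']

/-- The pair `(γ_v(-∞), γ_v(∞))` of points at infinity of the geodesic `γ_v`. -/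
def UnitTangent.ends (v : UnitTangent n) : SphereInf n × SphereInf n :=
  (⟨ray v.bwd, ray_mem v.bwd_bwd v.bwd_pos⟩, ⟨ray v.fwd, ray_mem v.fwd_fwd v.fwd_pos⟩)

lemma UnitTangent.ends_ne (v : UnitTangent n) : v.ends.1 ≠ v.ends.2 := by
  intro h
  have h1 : ray v.bwd = ray v.fwd := congrArg Subtype.val h
  have h2 := v.fwd_bwd
  have h3 := v.fwd_fwd
  have hb := v.bwd_pos
  have hf := v.fwd_pos
  rw [eq_smul_ray hf, mink_smul_left, mink_smul_right] at h3
  rw [eq_smul_ray hf, eq_smul_ray hb, h1, mink_smul_left, mink_smul_right] at h2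
  have : mink ((1 : ℝ), ray v.fwd) (1, ray v.fwd) = 0 := by
    rcases mul_eq_zero.1 h3 with h | h
    · exact absurd h hf.ne'
    · exact (mul_eq_zero.1 h).resolve_left hf.ne'
  rw [this] at h2
  norm_num at h2

/-- The space `(S^n × S^n) - Δ` of pairs of distinct points at infinity. -/
def EndPairs (n : ℕ) : TopologicalSpace.Opens (SphereInf n × SphereInf n) :=
  ⟨{x | x.1 ≠ x.2}, isOpen_ne_fun continuous_fst continuous_snd⟩

/-- The points at infinity of a geodesic in the boundary of the ball model, as limits. -/
lemma UnitTangent.tendsto_fwd (v : UnitTangent n) :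
    Filter.Tendsto (fun t => ray (v.geodesic.toFun t)) Filter.atTop (nhds (v.ends.2 : _)) := by
  have hfun : (fun t => ray (v.geodesic.toFun t)) =
      fun t => ray (v.fwd + Real.exp (-(2 * t)) • v.bwd) := by
    funext t
    have h : Real.exp t * Real.exp (-(2 * t)) = Real.exp (-t) := by
      rw [← Real.exp_add]; congr 1; ring
    have h2 : v.geodesic.toFun t =
        (Real.exp t / 2) • (v.fwd + Real.exp (-(2 * t)) • v.bwd) := by
      rw [smul_add, smul_smul, div_mul_eq_mul_div, h]
      simp only [UnitTangent.geodesic, UnitTangent.fwd, UnitTangent.bwd, Real.cosh_eq,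
        Real.sinh_eq]
      module
    rw [h2, ray_smul (by positivity)]
  have h1 : Filter.Tendsto (fun t : ℝ => v.fwd + Real.exp (-(2 * t)) • v.bwd) Filter.atTop
      (nhds (v.fwd + (0 : ℝ) • v.bwd)) := by
    refine tendsto_const_nhds.add (Filter.Tendsto.smul_const ?_ _)
    exact Real.tendsto_exp_neg_atTop_nhds_zero.comp (Filter.tendsto_id.const_mul_atTop two_pos)
  rw [zero_smul, add_zero] at h1
  rw [hfun]
  exact (((continuous_fst.tendsto _).comp h1).inv₀ v.fwd_pos.ne').smul
    ((continuous_snd.tendsto _).comp h1)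

lemma UnitGeodesic.fwd_translate {γ δ : UnitGeodesic n} {c : ℝ}
    (h : ∀ t, δ.toFun t = γ.toFun (t + c)) :
    (δ.velocity 0).fwd = Real.exp c • (γ.velocity 0).fwd ∧
    (δ.velocity 0).bwd = Real.exp (-c) • (γ.velocity 0).bwd := by
  have h1 : (δ.velocity 0).pt = γ.toFun c := by simp [velocity, h]
  have h2 : (δ.velocity 0).vec = deriv γ.toFun c := by
    simp only [velocity]
    rw [show δ.toFun = fun t => γ.toFun (t + c) from funext h, deriv_comp_add_const, zero_add]
  have h3 : γ.toFun c = ((γ.velocity 0).flow c).pt := by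
    rw [UnitTangent.flow_pt]; exact γ.eq_cosh_sinh c
  have h4 : deriv γ.toFun c = ((γ.velocity 0).flow c).vec := by
    rw [UnitTangent.flow_vec]
    conv_lhs => rw [γ.eq_geodesic]
    exact UnitTangent.deriv_geodesic _ c
  rw [h3] at h1
  rw [h4] at h2
  simp only [UnitTangent.fwd, UnitTangent.bwd, h1, h2, UnitTangent.flow_pt, UnitTangent.flow_vec,
    Real.cosh_eq, Real.sinh_eq]
  constructor <;> module

/-- The map `F` sending an oriented geodesic `[γ]` to `(γ(-∞), γ(∞))`. -/
def OrientedGeodesic.ends : OrientedGeodesic n → EndPairs n :=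
  Quotient.lift (fun γ => ⟨(γ.velocity 0).ends, (γ.velocity 0).ends_ne⟩) (by
    rintro γ δ ⟨c, h⟩
    obtain ⟨hf, hb⟩ := UnitGeodesic.fwd_translate h
    apply Subtype.ext
    apply Prod.ext <;> apply Subtype.ext
    · simp only [UnitTangent.ends, hb, ray_smul (Real.exp_ne_zero _)]
    · simp only [UnitTangent.ends, hf, ray_smul (Real.exp_ne_zero _)])

lemma ends_line (γ : UnitGeodesic n) : (γ.line.ends : SphereInf n × SphereInf n) =
    (γ.velocity 0).ends := rfl

lemma UnitTangent.ends_geodesic_line (v : UnitTangent n) :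
    (v.geodesic.line.ends : SphereInf n × SphereInf n) = v.ends := by
  rw [ends_line]
  congr 1
  apply UnitTangent.ext
  · exact v.geodesic_zero
  · simp [UnitGeodesic.velocity, v.deriv_geodesic]

lemma OrientedGeodesic.ends_injective : Function.Injective (ends (n := n)) := by
  intro a b
  refine Quotient.inductionOn₂ a b fun γ δ h => Quotient.sound ?_
  have h := congrArg Subtype.val h
  have hb : ray (γ.velocity 0).bwd = ray (δ.velocity 0).bwd :=
    congrArg Subtype.val (congrArg Prod.fst h)
  have hf : ray (γ.velocity 0).fwd = ray (δ.velocity 0).fwd :=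
    congrArg Subtype.val (congrArg Prod.snd h)
  set v := γ.velocity 0 with hv
  set w := δ.velocity 0 with hw
  have pvf := v.fwd_pos
  have pvb := v.bwd_pos
  have pwf := w.fwd_pos
  have pwb := w.bwd_pos
  have e1 : w.fwd = (w.fwd.1 / v.fwd.1) • v.fwd := by
    conv_lhs => rw [eq_smul_ray pwf, ← hf]
    conv_rhs => rw [eq_smul_ray pvf]
    rw [smul_smul]; congr 1
    simp only [Prod.smul_fst, smul_eq_mul, mul_one]; field_simp
  have e2 : w.bwd = (w.bwd.1 / v.bwd.1) • v.bwd := by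
    conv_lhs => rw [eq_smul_ray pwb, ← hb]
    conv_rhs => rw [eq_smul_ray pvb]
    rw [smul_smul]; congr 1
    simp only [Prod.smul_fst, smul_eq_mul, mul_one]; field_simp
  generalize ha : w.fwd.1 / v.fwd.1 = x at e1
  generalize hy : w.bwd.1 / v.bwd.1 = y at e2
  have hx : 0 < x := ha ▸ div_pos pwf pvf
  have hxy : x * y = 1 := by
    have := w.fwd_bwd
    rw [e1, e2, mink_smul_left, mink_smul_right, v.fwd_bwd] at this
    linarith
  have hyx : y = Real.exp (-Real.log x) := by
    rw [Real.exp_neg, Real.exp_log hx]; exact eq_inv_of_mul_eq_one_right hxy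
  rw [hyx] at e2
  have hpt : w.pt = (1 / 2 : ℝ) • (w.fwd + w.bwd) := by
    simp only [UnitTangent.fwd, UnitTangent.bwd]; module
  have hvec : w.vec = (1 / 2 : ℝ) • (w.fwd - w.bwd) := by
    simp only [UnitTangent.fwd, UnitTangent.bwd]; module
  refine ⟨Real.log x, fun t => ?_⟩
  rw [γ.eq_geodesic, δ.eq_geodesic, ← hv, ← hw]
  simp only [UnitTangent.geodesic]
  rw [hpt, hvec, e1, e2]
  simp only [UnitTangent.fwd, UnitTangent.bwd, Real.cosh_eq, Real.sinh_eq, Real.exp_add, neg_add,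
    Real.exp_log hx]
  module

lemma mink_sphere {q r : EuclideanSpace ℝ (Fin (n + 1))} (a b : ℝ) :
    mink (a, q) (b, r) = inner ℝ q r - a * b := rfl

lemma inner_lt_one {q r : SphereInf n} (h : q ≠ r) :
    inner ℝ (q : EuclideanSpace ℝ (Fin (n + 1))) r < 1 := by
  have h1 : ‖(q : EuclideanSpace ℝ (Fin (n + 1)))‖ = 1 := norm_eq_of_mem_sphere q
  have h2 : ‖(r : EuclideanSpace ℝ (Fin (n + 1)))‖ = 1 := norm_eq_of_mem_sphere r
  exact (inner_lt_one_iff_real_of_norm_eq_one h1 h2).2 fun h' => h (Subtype.ext h')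

lemma null_sphere (q : SphereInf n) (a : ℝ) :
    mink (a • ((1 : ℝ), (q : EuclideanSpace ℝ (Fin (n + 1)))))
      (a • ((1 : ℝ), (q : EuclideanSpace ℝ (Fin (n + 1))))) = 0 := by
  have h1 : ‖(q : EuclideanSpace ℝ (Fin (n + 1)))‖ = 1 := norm_eq_of_mem_sphere q
  rw [mink_smul_left, mink_smul_right, mink_sphere, real_inner_self_eq_norm_sq, h1]; ring

lemma OrientedGeodesic.ends_surjective : Function.Surjective (ends (n := n)) := by
  rintro ⟨⟨q, r⟩, hqr⟩
  have hlt := inner_lt_one hqr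
  rw [real_inner_comm] at hlt
  set a : ℝ := Real.sqrt (2 / (1 - inner ℝ (r : EuclideanSpace ℝ (Fin (n + 1))) q)) with ha
  have hpos : 0 < 2 / (1 - inner ℝ (r : EuclideanSpace ℝ (Fin (n + 1))) q) :=
    div_pos two_pos (by linarith)
  have ha0 : 0 < a := Real.sqrt_pos.2 hpos
  let v : UnitTangent n := UnitTangent.ofNull 
    (a • ((1 : ℝ), (r : EuclideanSpace ℝ (Fin (n + 1)))))
    (a • ((1 : ℝ), (q : EuclideanSpace ℝ (Fin (n + 1)))))
    (null_sphere r a) (null_sphere q a)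
    (by
      rw [mink_smul_left, mink_smul_right, mink_sphere, ← mul_assoc, ← pow_two, ha,
        Real.sq_sqrt hpos.le]
      field_simp [show (1 - inner ℝ (r : EuclideanSpace ℝ (Fin (n + 1))) q) ≠ 0 by linarith]
      ring)
    (by simp; linarith)
  have hf : v.fwd = a • ((1 : ℝ), (r : EuclideanSpace ℝ (Fin (n + 1)))) := by
    simp only [v, UnitTangent.fwd, UnitTangent.ofNull]; module
  have hb : v.bwd = a • ((1 : ℝ), (q : EuclideanSpace ℝ (Fin (n + 1)))) := by
    simp only [v, UnitTangent.bwd, UnitTangent.ofNull]; module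
  refine ⟨v.geodesic.line, Subtype.ext ?_⟩
  rw [v.ends_geodesic_line]
  apply Prod.ext <;> apply Subtype.ext
  · simp only [UnitTangent.ends, hb, ray_smul ha0.ne']; simp [ray]
  · simp only [UnitTangent.ends, hf, ray_smul ha0.ne']; simp [ray]

end Endpoints

section Manifold
variable {n : ℕ}

/-- `F` is a bijection from the space of oriented geodesics onto `(S^n × S^n) - Δ`. -/
def endsEquiv (n : ℕ) : OrientedGeodesic n ≃ EndPairs n :=
  Equiv.ofBijective OrientedGeodesic.ends
    ⟨OrientedGeodesic.ends_injective, OrientedGeodesic.ends_surjective⟩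

/-- The topology which makes `F` a homeomorphism. -/
instance : TopologicalSpace (OrientedGeodesic n) :=
  TopologicalSpace.induced OrientedGeodesic.ends inferInstance

/-- `F` as a homeomorphism. -/
def endsHomeo (n : ℕ) : OrientedGeodesic n ≃ₜ EndPairs n :=
  (endsEquiv n).toHomeomorphOfIsInducing ⟨rfl⟩

/-- The model space `ℝ^n × ℝ^n` of the space of oriented geodesics. -/
abbrev LineModel (n : ℕ) : Type :=
  ModelProd (EuclideanSpace ℝ (Fin n)) (EuclideanSpace ℝ (Fin n))

/-- The model with corners (boundaryless, of dimension `2 n`) of the space of oriented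
geodesics. -/
abbrev lineModel (n : ℕ) := (𝓡 n).prod (𝓡 n)

/-- The smooth structure which makes `F` a diffeomorphism. -/
instance : ChartedSpace (LineModel n) (OrientedGeodesic n) where
  atlas := {e | ∃ f ∈ atlas (LineModel n) (EndPairs n),
    e = (endsHomeo n).transOpenPartialHomeomorph f}
  chartAt ℓ := (endsHomeo n).transOpenPartialHomeomorph (chartAt (LineModel n) (endsHomeo n ℓ))
  mem_chart_source ℓ := mem_chart_source (LineModel n) (endsHomeo n ℓ)
  chart_mem_atlas _ := ⟨_, chart_mem_atlas _ _, rfl⟩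

instance : IsManifold (lineModel n) ∞ (OrientedGeodesic n) where
  compatible := by
    rintro _ _ ⟨e, he, rfl⟩ ⟨e', he', rfl⟩
    have h : ((endsHomeo n).transOpenPartialHomeomorph e).symm ≫ₕ
        ((endsHomeo n).transOpenPartialHomeomorph e') = e.symm ≫ₕ e' := by
      ext <;> simp
    rw [h]
    exact HasGroupoid.compatible he he'

/-- `F` is a diffeomorphism. -/
def endsDiffeo (n : ℕ) : OrientedGeodesic n ≃ₘ^∞⟮lineModel n, lineModel n⟯ EndPairs n where
  toEquiv := endsEquiv n
  contMDiff_toFun ℓ := contMDiffAt_iff.2 ⟨(endsHomeo n).continuous.continuousAt,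
    (contMDiffAt_iff.1 (contMDiffAt_id (I := lineModel n) (x := endsHomeo n ℓ))).2.congr
      (fun y _ => congrArg (extChartAt (lineModel n) (endsHomeo n ℓ))
        ((endsHomeo n).apply_symm_apply _))
      (congrArg (extChartAt (lineModel n) (endsHomeo n ℓ)) ((endsHomeo n).apply_symm_apply _))⟩
  contMDiff_invFun x := by
    obtain ⟨ℓ, rfl⟩ := (endsHomeo n).surjective x
    refine contMDiffAt_iff.2 ⟨(endsHomeo n).symm.continuous.continuousAt, ?_⟩
    have hℓ : (endsEquiv n).symm (endsHomeo n ℓ) = ℓ := (endsEquiv n).symm_apply_apply ℓ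
    change ContDiffWithinAt ℝ ∞ (extChartAt (lineModel n) ((endsEquiv n).symm (endsHomeo n ℓ)) ∘
      (endsEquiv n).symm ∘ (extChartAt (lineModel n) (endsHomeo n ℓ)).symm) _ _
    rw [hℓ]
    exact (contMDiffAt_iff.1 (contMDiffAt_id (I := lineModel n) (x := endsHomeo n ℓ))).2.congr
      (fun y _ => congrArg (extChartAt (lineModel n) (endsHomeo n ℓ))
        ((endsHomeo n).apply_symm_apply _))
      (congrArg (extChartAt (lineModel n) (endsHomeo n ℓ)) ((endsHomeo n).apply_symm_apply _))

end Manifold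

/-! ### Smooth maps to the space of oriented geodesics -/

section Smooth
variable {n : ℕ}

lemma contMDiff_ends_iff {E H M : Type*} [NormedAddCommGroup E] [NormedSpace ℝ E]
    [TopologicalSpace H] {I : ModelWithCorners ℝ E H} [TopologicalSpace M] [ChartedSpace H M]
    {f : M → OrientedGeodesic n} :
    ContMDiff I (lineModel n) ∞ f ↔
      ContMDiff I (lineModel n) ∞ (fun m => ((f m).ends : SphereInf n × SphereInf n)) := by
  constructor
  · intro h
    exact contMDiff_subtype_val.comp ((endsDiffeo n).contMDiff.comp h)
  · intro h
    have h1 : ContMDiff I (lineModel n) ∞ (fun m => endsDiffeo n (f m)) :=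
      (ContMDiff.subtypeVal_comp_iff (EndPairs n) _).1 h
    have h2 := (endsDiffeo n).symm.contMDiff.comp h1
    convert h2 using 1
    funext m
    exact ((endsDiffeo n).symm_apply_apply (f m)).symm

/-- The canonical projection `T¹H → 𝓛`, `v ↦ [γ_v]`, is smooth. -/
lemma contMDiff_line {E H M : Type*} [NormedAddCommGroup E] [NormedSpace ℝ E]
    [TopologicalSpace H] {I : ModelWithCorners ℝ E H} [TopologicalSpace M] [ChartedSpace H M]
    [IsManifold I ∞ M] {G : M → UnitGeodesic n}
    (hp : ContMDiff I 𝓘(ℝ, Mink n) ∞ (fun m => ((G m).velocity 0).pt))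
    (hv : ContMDiff I 𝓘(ℝ, Mink n) ∞ (fun m => ((G m).velocity 0).vec)) :
    ContMDiff I (lineModel n) ∞ (fun m => (G m).line) := by
  rw [contMDiff_ends_iff]
  have hf : ContMDiff I 𝓘(ℝ, Mink n) ∞ (fun m => ((G m).velocity 0).fwd) := hp.add hv
  have hb : ContMDiff I 𝓘(ℝ, Mink n) ∞ (fun m => ((G m).velocity 0).bwd) := hp.sub hv
  have hray : ∀ {u : M → Mink n}, ContMDiff I 𝓘(ℝ, Mink n) ∞ u → (∀ m, 0 < (u m).1) →
      ContMDiff I 𝓘(ℝ, EuclideanSpace ℝ (Fin (n + 1))) ∞ (fun m => ray (u m)) := by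
    intro u hu hpos m
    have : ContDiffAt ℝ ∞ (ray (n := n)) (u m) :=
      (contDiffAt_fst.inv (hpos m).ne').smul contDiffAt_snd
    exact this.contMDiffAt.comp m (hu m)
  have : Fact (Module.finrank ℝ (EuclideanSpace ℝ (Fin (n + 1))) = n + 1) :=
    ⟨finrank_euclideanSpace_fin⟩
  exact ((hray hb fun m => ((G m).velocity 0).bwd_pos).codRestrict_sphere
      (fun m => ray_mem ((G m).velocity 0).bwd_bwd ((G m).velocity 0).bwd_pos)).prodMk
    ((hray hf fun m => ((G m).velocity 0).fwd_pos).codRestrict_sphere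
      (fun m => ray_mem ((G m).velocity 0).fwd_fwd ((G m).velocity 0).fwd_pos))

/-- `F` followed by the inclusion of `S^n × S^n` in `ℝ^{n+1} × ℝ^{n+1}`. -/
def endVec (ℓ : OrientedGeodesic n) :
    EuclideanSpace ℝ (Fin (n + 1)) × EuclideanSpace ℝ (Fin (n + 1)) :=
  ((ℓ.ends : SphereInf n × SphereInf n).1, (ℓ.ends : SphereInf n × SphereInf n).2)

lemma contMDiff_endVec : ContMDiff (lineModel n)
    𝓘(ℝ, EuclideanSpace ℝ (Fin (n + 1)) × EuclideanSpace ℝ (Fin (n + 1))) ∞ (endVec (n := n)) := by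
  have h := contMDiff_ends_iff.1 (contMDiff_id (I := lineModel n) (M := OrientedGeodesic n))
  have : Fact (Module.finrank ℝ (EuclideanSpace ℝ (Fin (n + 1))) = n + 1) :=
    ⟨finrank_euclideanSpace_fin⟩
  exact ((contMDiff_coe_sphere (n := n)).comp (contMDiff_fst.comp h)).prodMk_space
    ((contMDiff_coe_sphere (n := n)).comp (contMDiff_snd.comp h))

lemma mdifferentiable_endVec : MDifferentiable (lineModel n)
    𝓘(ℝ, EuclideanSpace ℝ (Fin (n + 1)) × EuclideanSpace ℝ (Fin (n + 1))) (endVec (n := n)) :=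
  contMDiff_endVec.mdifferentiable (by simp)

lemma injective_mfderiv_val (x : EndPairs n) : Function.Injective
    (mfderiv (lineModel n) (lineModel n) (Subtype.val : EndPairs n → SphereInf n × SphereInf n) x) := by
  classical
  let g : SphereInf n × SphereInf n → EndPairs n := fun y => if h : y ∈ EndPairs n then ⟨y, h⟩ else x
  have hg : g ∘ (Subtype.val : EndPairs n → _) = id := by
    funext y; simp [g]
  have h1 : ContMDiffAt (lineModel n) (lineModel n) ∞ (g ∘ (Subtype.val : EndPairs n → _)) x := by
    rw [hg]; exact contMDiffAt_id
  have h2 : ContMDiffAt (lineModel n) (lineModel n) ∞ g (x : SphereInf n × SphereInf n) :=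
    contMDiffAt_subtype_iff.1 h1
  have h3 := mfderiv_comp x (h2.mdifferentiableAt (by simp))
    ((contMDiff_subtype_val (n := ∞) (U := EndPairs n) (I := lineModel n)).mdifferentiableAt
      (by simp))
  rw [hg, mfderiv_id] at h3
  intro a b hab
  have ha : a = mfderiv (lineModel n) (lineModel n) g x (mfderiv (lineModel n) (lineModel n)
    (Subtype.val : EndPairs n → SphereInf n × SphereInf n) x a) := DFunLike.congr_fun h3 a
  have hb : b = mfderiv (lineModel n) (lineModel n) g x (mfderiv (lineModel n) (lineModel n)
    (Subtype.val : EndPairs n → SphereInf n × SphereInf n) x b) := DFunLike.congr_fun h3 b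
  rw [ha, hab, ← hb]

lemma injective_mfderiv_endVec (ℓ : OrientedGeodesic n) : Function.Injective
    (mvfderiv (lineModel n) (endVec (n := n)) ℓ) := by
  have : Fact (Module.finrank ℝ (EuclideanSpace ℝ (Fin (n + 1))) = n + 1) :=
    ⟨finrank_euclideanSpace_fin⟩
  have hF : HasMFDerivAt (lineModel n) (lineModel n) (endsDiffeo n) ℓ _ :=
    ((endsDiffeo n).mdifferentiable (by simp) ℓ).hasMFDerivAt
  have hv : HasMFDerivAt (lineModel n) (lineModel n)
      (Subtype.val : EndPairs n → SphereInf n × SphereInf n) (endsDiffeo n ℓ) _ :=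
    ((contMDiff_subtype_val (n := ∞)).mdifferentiableAt (by simp)).hasMFDerivAt
  have hc : ∀ q : SphereInf n, HasMFDerivAt (𝓡 n) 𝓘(ℝ, EuclideanSpace ℝ (Fin (n + 1)))
      (Subtype.val : SphereInf n → EuclideanSpace ℝ (Fin (n + 1))) q _ := fun q =>
    (((contMDiff_coe_sphere (n := n)) q).mdifferentiableAt one_ne_zero).hasMFDerivAt
  have hvF := hv.comp ℓ hF
  have h1 := (hc _).comp ℓ ((hasMFDerivAt_fst _).comp ℓ hvF)
  have h2 := (hc _).comp ℓ ((hasMFDerivAt_snd _).comp ℓ hvF)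
  have hE := (mdifferentiable_endVec ℓ).hasMFDerivAt
  have k1 := (ContinuousLinearMap.fst ℝ (EuclideanSpace ℝ (Fin (n + 1)))
    (EuclideanSpace ℝ (Fin (n + 1)))).hasMFDerivAt.comp ℓ hE
  have k2 := (ContinuousLinearMap.snd ℝ (EuclideanSpace ℝ (Fin (n + 1)))
    (EuclideanSpace ℝ (Fin (n + 1)))).hasMFDerivAt.comp ℓ hE
  have e1 := hasMFDerivAt_unique k1 h1
  have e2 := hasMFDerivAt_unique k2 h2
  intro a b hab
  have hab' : mfderiv (lineModel n) 𝓘(ℝ, EuclideanSpace ℝ (Fin (n + 1)) ×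
    EuclideanSpace ℝ (Fin (n + 1))) (endVec (n := n)) ℓ a = mfderiv (lineModel n)
    𝓘(ℝ, EuclideanSpace ℝ (Fin (n + 1)) × EuclideanSpace ℝ (Fin (n + 1))) (endVec (n := n)) ℓ b :=
    hab
  have a1 := DFunLike.congr_fun e1 a
  have b1 := DFunLike.congr_fun e1 b
  have a2 := DFunLike.congr_fun e2 a
  have b2 := DFunLike.congr_fun e2 b
  have c1 := a1.symm.trans ((congrArg Prod.fst hab').trans b1)
  have c2 := a2.symm.trans ((congrArg Prod.snd hab').trans b2)
  have d1 := injective_mvfderiv_subtypeVal_sphere (n := n)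
    (E := EuclideanSpace ℝ (Fin (n + 1))) (ℓ.ends : SphereInf n × SphereInf n).1 c1
  have d2 := injective_mvfderiv_subtypeVal_sphere (n := n)
    (E := EuclideanSpace ℝ (Fin (n + 1))) (ℓ.ends : SphereInf n × SphereInf n).2 c2
  have d : mfderiv (lineModel n) (lineModel n) (endsDiffeo n) ℓ a =
      mfderiv (lineModel n) (lineModel n) (endsDiffeo n) ℓ b :=
    injective_mfderiv_val _ (Prod.ext d1 d2)
  exact ((endsDiffeo n).mfderivToContinuousLinearEquiv (by simp) ℓ).injective d

end Smooth
/-! ### The canonical metric of the space of oriented geodesics -/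

section Metric
variable {n : ℕ}

/-- The variation field `J(s) = d/dt|₀ γ_t(s)` of a family of geodesics `γ_t = Γ t`. -/
def variationField (Γ : ℝ → UnitGeodesic n) (s : ℝ) : Mink n :=
  deriv (fun t => (Γ t).toFun s) 0

/-- `Γ` is a smooth variation by unit speed geodesics of the geodesic `γ = Γ 0`, whose associated
Jacobi field `J` along `γ` is orthogonal to `γ'`, such that the tangent vector `X` of the space of
oriented geodesics is `d/dt|₀ [Γ t]`; that is, `X = T_γ(J)`. -/
structure IsVariation (Γ : ℝ → UnitGeodesic n)
    (X : TangentBundle (lineModel n) (OrientedGeodesic n)) : Prop where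
  smooth : ContDiff ℝ ∞ (fun x : ℝ × ℝ => (Γ x.1).toFun x.2)
  orthogonal : ∀ s, mink (variationField Γ s) (deriv (Γ 0).toFun s) = 0
  tangent : tangentMap 𝓘(ℝ, ℝ) (lineModel n) (fun t => (Γ t).line) ⟨0, 1⟩ = X

/-- `|J|² - |J'|²` at time `s`, where `J` is the variation field of `Γ` and `J'` is its covariant
derivative along `Γ 0`. -/
def jacobiNorm (Γ : ℝ → UnitGeodesic n) (s : ℝ) : ℝ :=
  mink (variationField Γ s) (variationField Γ s) -
    mink (covDeriv (Γ 0).toFun (variationField Γ) s) (covDeriv (Γ 0).toFun (variationField Γ) s)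

/-- The square norm `4 ⟨T x, y⟩ / |q - p|²` on `(S^n × S^n) - Δ`, with `T` the reflection with
respect to the hyperplane orthogonal to `p - q`. -/
def pairNorm (p q x y : EuclideanSpace ℝ (Fin (n + 1))) : ℝ :=
  4 * inner ℝ (x - (2 * inner ℝ x (p - q) / ‖p - q‖ ^ 2) • (p - q)) y / ‖q - p‖ ^ 2

lemma contDiff_deriv_zero {Γ : ℝ → UnitGeodesic n}
    (h : ContDiff ℝ ∞ (fun x : ℝ × ℝ => (Γ x.1).toFun x.2)) :
    ContDiff ℝ ∞ (fun t => (Γ t).toFun 0) ∧ ContDiff ℝ ∞ (fun t => deriv (Γ t).toFun 0) := by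
  refine ⟨h.comp (contDiff_id.prodMk contDiff_const), ?_⟩
  have h1 : ∀ t, deriv (Γ t).toFun 0 =
      fderiv ℝ (fun x : ℝ × ℝ => (Γ x.1).toFun x.2) (t, 0) (0, 1) := by
    intro t
    have hd : HasFDerivAt (fun x : ℝ × ℝ => (Γ x.1).toFun x.2) _ (t, (0 : ℝ)) :=
      (h.differentiable (by simp) (t, 0)).hasFDerivAt
    have hc : HasDerivAt (fun s : ℝ => (t, s)) ((0 : ℝ), (1 : ℝ)) 0 :=
      (hasDerivAt_const (0 : ℝ) t).prodMk (hasDerivAt_id 0)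
    exact (hd.comp_hasDerivAt (0 : ℝ) hc).deriv
  simp only [h1]
  have h2 : ContDiff ℝ ∞ (fderiv ℝ (fun x : ℝ × ℝ => (Γ x.1).toFun x.2)) :=
    h.fderiv_right (by simp)
  exact (h2.comp (contDiff_id.prodMk contDiff_const)).clm_apply contDiff_const

/-- Null vectors of a variation determine the square norm of the variation field. -/
lemma jacobiNorm_eq {Γ : ℝ → UnitGeodesic n} {U' W' : Mink n}
    (hU : HasDerivAt (fun t => ((Γ t).velocity 0).fwd) U' 0)
    (hW : HasDerivAt (fun t => ((Γ t).velocity 0).bwd) W' 0)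
    (horth : mink (variationField Γ 0) (deriv (Γ 0).toFun 0) = 0) (s : ℝ) :
    mink U' ((Γ 0).velocity 0).bwd = 0 ∧ mink W' ((Γ 0).velocity 0).fwd = 0 ∧
      jacobiNorm Γ s = mink U' W' := by
  have hΓ : ∀ t s, (Γ t).toFun s = (1 / 2 : ℝ) • (Real.exp s • ((Γ t).velocity 0).fwd +
      Real.exp (-s) • ((Γ t).velocity 0).bwd) := by
    intro t s
    conv_lhs => rw [(Γ t).eq_geodesic]
    simp only [UnitTangent.geodesic, UnitTangent.fwd, UnitTangent.bwd, Real.cosh_eq, Real.sinh_eq]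
    module
  have hJ : variationField Γ = fun s => (1 / 2 : ℝ) • (Real.exp s • U' + Real.exp (-s) • W') := by
    funext s
    simp only [variationField, hΓ]
    exact (((hU.const_smul (Real.exp s)).add (hW.const_smul (Real.exp (-s)))).const_smul
      (1 / 2 : ℝ)).deriv
  have hJ' : ∀ s, deriv (variationField Γ) s =
      (1 / 2 : ℝ) • (Real.exp s • U' - Real.exp (-s) • W') := by
    intro s
    rw [hJ]
    have h1 : HasDerivAt (fun s => Real.exp (-s)) (-Real.exp (-s)) s := by
      simpa using (hasDerivAt_neg s).exp
    have := (((Real.hasDerivAt_exp s).smul_const U').add (h1.smul_const W')).const_smul (1 / 2 : ℝ)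
    exact (this.congr_deriv (by module)).deriv
  have huu : mink U' ((Γ 0).velocity 0).fwd = 0 := by
    have h := hasDerivAt_mink hU hU
    rw [show (fun t => mink ((Γ t).velocity 0).fwd ((Γ t).velocity 0).fwd) = fun _ => (0 : ℝ) from
      funext fun t => ((Γ t).velocity 0).fwd_fwd] at h
    have := h.unique (hasDerivAt_const 0 (0 : ℝ))
    rw [mink_comm _ U'] at this
    linarith
  have hww : mink W' ((Γ 0).velocity 0).bwd = 0 := by
    have h := hasDerivAt_mink hW hW
    rw [show (fun t => mink ((Γ t).velocity 0).bwd ((Γ t).velocity 0).bwd) = fun _ => (0 : ℝ) from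
      funext fun t => ((Γ t).velocity 0).bwd_bwd] at h
    have := h.unique (hasDerivAt_const 0 (0 : ℝ))
    rw [mink_comm _ W'] at this
    linarith
  have huw : mink W' ((Γ 0).velocity 0).fwd + mink U' ((Γ 0).velocity 0).bwd = 0 := by
    have h := hasDerivAt_mink hU hW
    rw [show (fun t => mink ((Γ t).velocity 0).fwd ((Γ t).velocity 0).bwd) = fun _ => (-2 : ℝ) from
      funext fun t => ((Γ t).velocity 0).fwd_bwd] at h
    have := h.unique (hasDerivAt_const 0 (-2 : ℝ))
    rwa [mink_comm _ W'] at this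
  have hv : deriv (Γ 0).toFun 0 =
      (1 / 2 : ℝ) • (((Γ 0).velocity 0).fwd - ((Γ 0).velocity 0).bwd) := by
    simp only [UnitTangent.fwd, UnitTangent.bwd, UnitGeodesic.velocity]; module
  rw [hJ, hv] at horth
  simp only [neg_zero, Real.exp_zero, one_smul, mink_smul_left, mink_smul_right, mink_add_left,
    mink_sub_right, huu, hww] at horth
  have e1 : mink U' ((Γ 0).velocity 0).bwd = 0 := by linarith
  have e2 : mink W' ((Γ 0).velocity 0).fwd = 0 := by linarith
  refine ⟨e1, e2, ?_⟩
  have hcov : covDeriv (Γ 0).toFun (variationField Γ) s =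
      (1 / 2 : ℝ) • (Real.exp s • U' - Real.exp (-s) • W') := by
    rw [covDeriv, hJ', hΓ 0 s]
    simp only [mink_smul_left, mink_smul_right, mink_sub_left, mink_add_right, huu, hww, e1, e2]
    simp
  have hexp : Real.exp s * Real.exp (-s) = 1 := by rw [← Real.exp_add]; simp
  rw [jacobiNorm, hcov, hJ]
  simp only [mink_smul_left, mink_smul_right, mink_sub_left, mink_add_left, mink_add_right,
    mink_sub_right, mink_comm W' U']
  linear_combination (mink U' W') * hexp

lemma mink_eq_pairNorm (q r : SphereInf n) (hqr : q ≠ r)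
    (x y : EuclideanSpace ℝ (Fin (n + 1))) (a b a' b' : ℝ)
    (hab : mink (a • ((1 : ℝ), (r : EuclideanSpace ℝ (Fin (n + 1)))))
      (b • ((1 : ℝ), (q : EuclideanSpace ℝ (Fin (n + 1))))) = -2)
    (hx : inner ℝ x (q : EuclideanSpace ℝ (Fin (n + 1))) = 0)
    (hy : inner ℝ y (r : EuclideanSpace ℝ (Fin (n + 1))) = 0)
    (h1 : mink (a' • ((1 : ℝ), (r : EuclideanSpace ℝ (Fin (n + 1)))) + a • ((0 : ℝ), y))
      (b • ((1 : ℝ), (q : EuclideanSpace ℝ (Fin (n + 1))))) = 0)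
    (h2 : mink (b' • ((1 : ℝ), (q : EuclideanSpace ℝ (Fin (n + 1)))) + b • ((0 : ℝ), x))
      (a • ((1 : ℝ), (r : EuclideanSpace ℝ (Fin (n + 1))))) = 0) :
    mink (a' • ((1 : ℝ), (r : EuclideanSpace ℝ (Fin (n + 1)))) + a • ((0 : ℝ), y))
      (b' • ((1 : ℝ), (q : EuclideanSpace ℝ (Fin (n + 1)))) + b • ((0 : ℝ), x)) =
    pairNorm (q : EuclideanSpace ℝ (Fin (n + 1))) r x y := by
  have hlt := inner_lt_one hqr
  have nq : ‖(q : EuclideanSpace ℝ (Fin (n + 1)))‖ = 1 := norm_eq_of_mem_sphere q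
  have nr : ‖(r : EuclideanSpace ℝ (Fin (n + 1)))‖ = 1 := norm_eq_of_mem_sphere r
  have hn : ‖(q : EuclideanSpace ℝ (Fin (n + 1))) - r‖ ^ 2 =
      2 * (1 - inner ℝ (q : EuclideanSpace ℝ (Fin (n + 1))) r) := by
    rw [norm_sub_sq_real, nq, nr]; ring
  have c1 := real_inner_comm (q : EuclideanSpace ℝ (Fin (n + 1))) r
  have c2 := real_inner_comm x (r : EuclideanSpace ℝ (Fin (n + 1)))
  have c3 := real_inner_comm y (q : EuclideanSpace ℝ (Fin (n + 1)))
  have c4 := real_inner_comm x y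
  have c5 := real_inner_comm y (r : EuclideanSpace ℝ (Fin (n + 1)))
  rw [pairNorm, norm_sub_rev (r : EuclideanSpace ℝ (Fin (n + 1))), hn]
  simp only [mink_smul_left, mink_smul_right, mink_add_left, mink_add_right, mink_sphere,
    inner_sub_left, inner_sub_right, real_inner_smul_left, hx] at *
  rw [c1] at hab h1
  rw [c1, c2, c3, c4, c5, hy]
  generalize inner ℝ (q : EuclideanSpace ℝ (Fin (n + 1))) r = C at *
  generalize inner ℝ x y = A at *
  generalize inner ℝ x (r : EuclideanSpace ℝ (Fin (n + 1))) = X at *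
  generalize inner ℝ y (q : EuclideanSpace ℝ (Fin (n + 1))) = Y at *
  have hc : 1 - C ≠ 0 := by linarith
  have hb : b ≠ 0 := by
    rintro rfl
    norm_num at hab
  have hp : a' * (C - 1) + a * Y = 0 := by
    have := (mul_eq_zero.1 h1).resolve_left hb
    linarith
  have ha' : a' = a * Y / (1 - C) := by rw [eq_div_iff hc]; linarith
  have hab' : a = 2 / (1 - C) / b := by
    rw [eq_div_iff hb, eq_div_iff hc]; linarith
  have hp' : a' * (C - 1 * 1) + a * (Y - 0 * 1) = 0 := by linarith
  rw [hp', ha', hab']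
  field_simp
  ring

end Metric

section Metric2
variable {n : ℕ}

lemma IsVariation.smooth_fwd {Γ : ℝ → UnitGeodesic n}
    {X : TangentBundle (lineModel n) (OrientedGeodesic n)} (h : IsVariation Γ X) :
    ContDiff ℝ ∞ (fun t => ((Γ t).velocity 0).fwd) ∧
    ContDiff ℝ ∞ (fun t => ((Γ t).velocity 0).bwd) :=
  ⟨(contDiff_deriv_zero h.smooth).1.add (contDiff_deriv_zero h.smooth).2,
    (contDiff_deriv_zero h.smooth).1.sub (contDiff_deriv_zero h.smooth).2⟩

lemma contMDiff_line_variation {Γ : ℝ → UnitGeodesic n}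
    (h : ContDiff ℝ ∞ (fun x : ℝ × ℝ => (Γ x.1).toFun x.2)) :
    ContMDiff 𝓘(ℝ, ℝ) (lineModel n) ∞ (fun t => (Γ t).line) :=
  contMDiff_line (contDiff_deriv_zero h).1.contMDiff (contDiff_deriv_zero h).2.contMDiff

lemma hasDerivAt_endVec {Γ : ℝ → UnitGeodesic n}
    (h : ContDiff ℝ ∞ (fun x : ℝ × ℝ => (Γ x.1).toFun x.2)) :
    HasDerivAt (fun t => endVec (Γ t).line)
      (mvfderiv (lineModel n) (endVec (n := n)) (Γ 0).line
        (mfderiv 𝓘(ℝ, ℝ) (lineModel n) (fun t => (Γ t).line) 0 (1 : ℝ))) 0 := by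
  have h1 := ((contMDiff_line_variation h).mdifferentiable (by simp) 0).hasMFDerivAt
  have h2 := (mdifferentiable_endVec (Γ 0).line).hasMFDerivAt.comp (0 : ℝ) h1
  have h3 : HasFDerivAt (𝕜 := ℝ) (E := ℝ)
      (F := EuclideanSpace ℝ (Fin (n + 1)) × EuclideanSpace ℝ (Fin (n + 1)))
      (fun t => endVec (Γ t).line) _ 0 := h2.hasFDerivAt
  exact h3.hasDerivAt

lemma hasDerivAt_ray {u : ℝ → Mink n} {u' : Mink n} {t : ℝ} (h : HasDerivAt u u' t)
    (hpos : 0 < (u t).1) :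
    HasDerivAt (fun s => ray (u s)) ((u t).1⁻¹ • (u'.2 - u'.1 • ray (u t))) t := by
  have f1 : HasDerivAt (fun s => (u s).1) u'.1 t := by
    have := h.hasFDerivAt.fst.hasDerivAt; simpa using this
  have f2 : HasDerivAt (fun s => (u s).2) u'.2 t := by
    have := h.hasFDerivAt.snd.hasDerivAt; simpa using this
  refine ((f1.inv hpos.ne').smul f2).congr_deriv ?_
  simp only [ray, smul_sub, smul_smul]
  have : -u'.1 / (u t).1 ^ 2 = - ((u t).1⁻¹ * (u'.1 * (u t).1⁻¹)) := by
    field_simp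
  rw [this]; module

/-- The derivative of `endVec` is tangent to the two spheres. -/
lemma inner_mvfderiv_endVec (ℓ : OrientedGeodesic n) (X : TangentSpace (lineModel n) ℓ) :
    inner ℝ (mvfderiv (lineModel n) (endVec (n := n)) ℓ X).1 (endVec ℓ).1 = 0 ∧
    inner ℝ (mvfderiv (lineModel n) (endVec (n := n)) ℓ X).2 (endVec ℓ).2 = 0 := by
  have hE := (mdifferentiable_endVec ℓ).hasMFDerivAt
  have aux : ∀ L : (EuclideanSpace ℝ (Fin (n + 1)) × EuclideanSpace ℝ (Fin (n + 1))) →L[ℝ]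
      EuclideanSpace ℝ (Fin (n + 1)), (∀ ℓ : OrientedGeodesic n, ‖L (endVec ℓ)‖ = 1) →
      inner ℝ (L (mvfderiv (lineModel n) (endVec (n := n)) ℓ X)) (L (endVec ℓ)) = 0 := by
    intro L hL
    have hd : HasFDerivAt (fun z => ‖L z‖ ^ 2) _ (endVec ℓ) := (L.hasFDerivAt).norm_sq
    have h1 := hd.hasMFDerivAt.comp ℓ hE
    have h2 : ((fun z => ‖L z‖ ^ 2) ∘ endVec (n := n)) = fun _ => (1 : ℝ) := by
      funext ℓ; simp [hL]
    rw [h2] at h1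
    have h3' := DFunLike.congr_fun (hasMFDerivAt_unique h1 (hasMFDerivAt_const (1 : ℝ) ℓ)) X
    have h4 : (2 : ℝ) * inner ℝ (L (endVec ℓ))
        (L (mvfderiv (lineModel n) (endVec (n := n)) ℓ X)) = 0 := by
      have e : (2 : ℝ) * inner ℝ (L (endVec ℓ))
          (L (mvfderiv (lineModel n) (endVec (n := n)) ℓ X)) = (2 : ℕ) • inner ℝ (L (endVec ℓ))
          (L (mvfderiv (lineModel n) (endVec (n := n)) ℓ X)) := by simp
      rw [e]
      exact h3'
    rw [real_inner_comm] at h4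
    linarith
  exact ⟨aux (ContinuousLinearMap.fst ℝ _ _) fun ℓ => norm_eq_of_mem_sphere ℓ.ends.1.1,
    aux (ContinuousLinearMap.snd ℝ _ _) fun ℓ => norm_eq_of_mem_sphere ℓ.ends.1.2⟩

/-- For every variation representing `X`, the number `|J|² - |J'|²` is given by the formula for the
metric of `(S^n × S^n) - Δ` at the image of `X` under the differential of `F`. -/
lemma IsVariation.jacobiNorm_eq_pairNorm {Γ : ℝ → UnitGeodesic n}
    {X : TangentBundle (lineModel n) (OrientedGeodesic n)} (h : IsVariation Γ X) (s : ℝ) :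
    jacobiNorm Γ s = pairNorm (endVec X.proj).1 (endVec X.proj).2
      (mvfderiv (lineModel n) (endVec (n := n)) X.proj X.snd).1
      (mvfderiv (lineModel n) (endVec (n := n)) X.proj X.snd).2 := by
  have hU := (h.smooth_fwd.1.differentiable (by simp) 0).hasDerivAt
  have hW := (h.smooth_fwd.2.differentiable (by simp) 0).hasDerivAt
  obtain ⟨hu, hw, hn⟩ := jacobiNorm_eq hU hW (h.orthogonal 0) s
  have hE := hasDerivAt_endVec h.smooth
  have horth := h.orthogonal
  obtain rfl := h.tangent
  change jacobiNorm Γ s = pairNorm (endVec (Γ 0).line).1 (endVec (Γ 0).line).2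
      (mvfderiv (lineModel n) (endVec (n := n)) (Γ 0).line
        (mfderiv 𝓘(ℝ, ℝ) (lineModel n) (fun t => (Γ t).line) 0 (1 : ℝ))).1
      (mvfderiv (lineModel n) (endVec (n := n)) (Γ 0).line
        (mfderiv 𝓘(ℝ, ℝ) (lineModel n) (fun t => (Γ t).line) 0 (1 : ℝ))).2
  obtain ⟨i1, i2⟩ := inner_mvfderiv_endVec (Γ 0).line
    (mfderiv 𝓘(ℝ, ℝ) (lineModel n) (fun t => (Γ t).line) 0 (1 : ℝ))
  generalize mvfderiv (lineModel n) (endVec (n := n)) (Γ 0).line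
        (mfderiv 𝓘(ℝ, ℝ) (lineModel n) (fun t => (Γ t).line) 0 (1 : ℝ)) = xy at *
  obtain ⟨x, y⟩ := xy
  have hx : HasDerivAt (fun t => ray ((Γ t).velocity 0).bwd) x 0 := by
    have h0 : HasDerivAt (fun t => (endVec (Γ t).line).1) x 0 := by
      have := hE.hasFDerivAt.fst.hasDerivAt; simpa using this
    exact h0
  have hy : HasDerivAt (fun t => ray ((Γ t).velocity 0).fwd) y 0 := by
    have h0 : HasDerivAt (fun t => (endVec (Γ t).line).2) y 0 := by
      have := hE.hasFDerivAt.snd.hasDerivAt; simpa using this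
    exact h0
  have ex := hx.unique (hasDerivAt_ray hW ((Γ 0).velocity 0).bwd_pos)
  have ey := hy.unique (hasDerivAt_ray hU ((Γ 0).velocity 0).fwd_pos)
  rw [hn]
  generalize deriv (fun t => ((Γ t).velocity 0).fwd) 0 = U' at *
  generalize deriv (fun t => ((Γ t).velocity 0).bwd) 0 = W' at *
  have key : ∀ (u u' : Mink n) (y : EuclideanSpace ℝ (Fin (n + 1))), 0 < u.1 →
      y = u.1⁻¹ • (u'.2 - u'.1 • ray u) → u' = u'.1 • ((1 : ℝ), ray u) + u.1 • ((0 : ℝ), y) := by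
    rintro u u' y hu rfl
    ext1
    · simp
    · simp [smul_smul, hu.ne']
  have kU := key _ _ _ ((Γ 0).velocity 0).fwd_pos ey
  have kW := key _ _ _ ((Γ 0).velocity 0).bwd_pos ex
  have huw := ((Γ 0).velocity 0).fwd_bwd
  rw [kU, eq_smul_ray ((Γ 0).velocity 0).bwd_pos] at hu
  rw [kW, eq_smul_ray ((Γ 0).velocity 0).fwd_pos] at hw
  rw [eq_smul_ray ((Γ 0).velocity 0).fwd_pos, eq_smul_ray ((Γ 0).velocity 0).bwd_pos] at huw
  rw [kU, kW]
  exact mink_eq_pairNorm ((Γ 0).velocity 0).ends.1 ((Γ 0).velocity 0).ends.2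
    ((Γ 0).velocity 0).ends_ne x y _ _ _ _ huw i1 i2 hu hw

end Metric2

section Metric3
variable {n : ℕ}

/-- Every tangent vector of the space of oriented geodesics is represented by a Jacobi field. -/
lemma exists_isVariation (X : TangentBundle (lineModel n) (OrientedGeodesic n)) :
    ∃ Γ, IsVariation Γ X := by
  obtain ⟨ℓ, X⟩ := X
  induction ℓ using Quotient.inductionOn with | _ γ => ?_
  change TangentSpace (lineModel n) γ.line at X
  obtain ⟨i1, i2⟩ := inner_mvfderiv_endVec γ.line X
  set xy := mvfderiv (lineModel n) (endVec (n := n)) γ.line X with hxy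
  set v := γ.velocity 0 with hv
  obtain ⟨x, y⟩ := xy
  change inner ℝ x (ray v.bwd) = 0 at i1
  change inner ℝ y (ray v.fwd) = 0 at i2
  -- null vectors orthogonal components
  obtain ⟨u, hu⟩ : ∃ u, u = v.fwd := ⟨_, rfl⟩
  obtain ⟨w, hw⟩ : ∃ w, w = v.bwd := ⟨_, rfl⟩
  have huu : mink u u = 0 := hu ▸ v.fwd_fwd
  have hww : mink w w = 0 := hw ▸ v.bwd_bwd
  have huw : mink u w = -2 := hu ▸ hw ▸ v.fwd_bwd
  have hwu : mink w u = -2 := by rw [mink_comm, huw]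
  have pu : 0 < u.1 := hu ▸ v.fwd_pos
  have pw : 0 < w.1 := hw ▸ v.bwd_pos
  rw [← hu] at i2
  rw [← hw] at i1
  have step : ∀ (u w : Mink n) (y : EuclideanSpace ℝ (Fin (n + 1))), 0 < u.1 → mink u u = 0 →
      mink u w = -2 → inner ℝ y (ray u) = 0 →
      ∃ Y : Mink n, mink Y u = 0 ∧ mink Y w = 0 ∧ u.1⁻¹ • (Y.2 - Y.1 • ray u) = y := by
    intro u w y pu huu huw hy
    have h0 : mink ((0 : ℝ), y) u = 0 := by
      rw [eq_smul_ray pu, mink_smul_right, mink_sphere, hy]; ring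
    refine ⟨u.1 • ((0 : ℝ), y) + (u.1 * mink ((0 : ℝ), y) w / 2) • u, ?_, ?_, ?_⟩
    · rw [mink_add_left, mink_smul_left, mink_smul_left, h0, huu]; ring
    · rw [mink_add_left, mink_smul_left, mink_smul_left, huw]; ring
    · generalize mink ((0 : ℝ), y) w = m
      have : u.2 = u.1 • ray u := by simp [ray, smul_smul, pu.ne']
      simp only [Prod.fst_add, Prod.snd_add, Prod.smul_fst, Prod.smul_snd, smul_eq_mul, mul_zero,
        zero_add]
      rw [this, smul_smul, add_sub_cancel_right, smul_smul, inv_mul_cancel₀ pu.ne', one_smul]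
  obtain ⟨Y, hYu, hYw, hYy⟩ := step u w y pu huu huw i2
  obtain ⟨Z, hZw, hZu, hZx⟩ := step w u x pw hww hwu i1
  let U : ℝ → Mink n := fun t => u + t • Y + (t ^ 2 * (mink Y Y / 4)) • w
  let W : ℝ → Mink n := fun t => w + t • (Z + (t * (mink Z Y / 2)) • w) +
    (t ^ 2 * (mink Z Z / 4)) • U t
  have cU : ContDiff ℝ ∞ U := by fun_prop
  have cW : ContDiff ℝ ∞ W := by fun_prop
  have dU : HasDerivAt U Y 0 := by
    have h := (((hasDerivAt_id (0 : ℝ)).smul_const Y).const_add u).add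
      ((((hasDerivAt_id (0 : ℝ)).pow 2).mul_const (mink Y Y / 4)).smul_const w)
    exact h.congr_deriv (by simp)
  have U0 : U 0 = u := by simp [U]
  have W0 : W 0 = w := by simp [W]
  have dW : HasDerivAt W Z 0 := by
    have h1 : HasDerivAt (fun t : ℝ => Z + (t * (mink Z Y / 2)) • w) ((mink Z Y / 2) • w) 0 :=
      ((((hasDerivAt_id (0 : ℝ)).mul_const (mink Z Y / 2)).smul_const w).const_add Z).congr_deriv
        (by simp)
    have h := (((hasDerivAt_id (0 : ℝ)).smul h1).const_add w).add
      ((((hasDerivAt_id (0 : ℝ)).pow 2).mul_const (mink Z Z / 4)).smul dU)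
    exact h.congr_deriv (by simp)
  have nU : ∀ t, mink (U t) (U t) = 0 := fun t => by
    simp only [U, mink_add_left, mink_add_right, mink_smul_left, mink_smul_right, huu, hww, huw,
      hwu, hYu, hYw, mink_comm u Y, mink_comm w Y]
    ring
  have UW0 : ∀ t, mink (U t) w = -2 := fun t => by
    simp only [U, mink_add_left, mink_smul_left, hww, huw, hYw]; ring
  have UZ : ∀ t, mink (U t) Z = t * mink Z Y := fun t => by
    simp only [U, mink_add_left, mink_smul_left, mink_comm u Z, mink_comm w Z, hZu, hZw,
      mink_comm Y Z]; ring
  have UW : ∀ t, mink (U t) (W t) = -2 := fun t => by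
    simp only [W, mink_add_right, mink_smul_right, UW0, UZ, nU]; ring
  have nW : ∀ t, mink (W t) (W t) = 0 := fun t => by
    simp only [W, mink_add_left, mink_add_right, mink_smul_left, mink_smul_right, UW0, UZ, nU,
      mink_comm _ (U t), hww, hZw, mink_comm w Z]; ring
  have pU : ∀ t, 0 < (U t).1 := fun t =>
    null_pos_of_pos (nU t) hww (by rw [UW0]; norm_num) pw
  have pW : ∀ t, 0 < (W t).1 := fun t =>
    null_pos_of_pos (nW t) (nU t) (by rw [mink_comm, UW]; norm_num) (pU t)
  let V : ℝ → UnitTangent n := fun t =>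
    UnitTangent.ofNull (U t) (W t) (nU t) (nW t) (UW t) (add_pos (pU t) (pW t))
  have Vf : ∀ t, (V t).fwd = U t := fun t => by
    simp only [V, UnitTangent.fwd, UnitTangent.ofNull]; module
  have Vb : ∀ t, (V t).bwd = W t := fun t => by
    simp only [V, UnitTangent.bwd, UnitTangent.ofNull]; module
  have hvel : ∀ t, ((V t).geodesic).velocity 0 = V t := fun t => by
    apply UnitTangent.ext
    · exact (V t).geodesic_zero
    · simp [UnitGeodesic.velocity, UnitTangent.deriv_geodesic]
  have V0 : V 0 = v := by
    apply UnitTangent.ext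
    · simp only [V, UnitTangent.ofNull, U0, W0, hu, hw, UnitTangent.fwd, UnitTangent.bwd]; module
    · simp only [V, UnitTangent.ofNull, U0, W0, hu, hw, UnitTangent.fwd, UnitTangent.bwd]; module
  have hΓ0 : (V 0).geodesic = γ := by rw [V0, hv, ← γ.eq_geodesic]
  have hsm : ContDiff ℝ ∞ (fun x : ℝ × ℝ => ((V x.1).geodesic).toFun x.2) := by
    have c1 : ContDiff ℝ ∞ (fun x : ℝ × ℝ => U x.1) := cU.comp contDiff_fst
    have c2 : ContDiff ℝ ∞ (fun x : ℝ × ℝ => W x.1) := cW.comp contDiff_fst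
    exact ((Real.contDiff_cosh.comp contDiff_snd).smul ((c1.add c2).const_smul (1 / 2 : ℝ))).add
      ((Real.contDiff_sinh.comp contDiff_snd).smul ((c1.sub c2).const_smul (1 / 2 : ℝ)))
  refine ⟨fun t => (V t).geodesic, hsm, fun s => ?_, ?_⟩
  · have hJ : variationField (fun t => (V t).geodesic) s =
        Real.cosh s • ((1 / 2 : ℝ) • (Y + Z)) + Real.sinh s • ((1 / 2 : ℝ) • (Y - Z)) := by
      exact ((((dU.add dW).const_smul (1 / 2 : ℝ)).const_smul (Real.cosh s)).add
        (((dU.sub dW).const_smul (1 / 2 : ℝ)).const_smul (Real.sinh s))).deriv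
    rw [hJ, UnitTangent.deriv_geodesic]
    simp only [V, UnitTangent.ofNull, U0, W0, mink_add_left, mink_add_right, mink_smul_left,
      mink_smul_right, mink_sub_left, mink_sub_right, hYu, hYw, hZu, hZw]
    ring
  · have hE := hasDerivAt_endVec (Γ := fun t => (V t).geodesic) hsm
    have hx : HasDerivAt (fun t => ray (W t)) x 0 := by
      have := hasDerivAt_ray dW (pW 0)
      rwa [W0, hZx] at this
    have hy : HasDerivAt (fun t => ray (U t)) y 0 := by
      have := hasDerivAt_ray dU (pU 0)
      rwa [U0, hYy] at this
    have hE2 : HasDerivAt (fun t => endVec (V t).geodesic.line) (x, y) 0 := by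
      have : (fun t => endVec (V t).geodesic.line) = fun t => (ray (W t), ray (U t)) := by
        funext t
        have h : endVec (V t).geodesic.line = (ray ((V t).geodesic.velocity 0).bwd,
          ray ((V t).geodesic.velocity 0).fwd) := rfl
        rw [h, hvel, Vf, Vb]
      rw [this]; exact hx.prodMk hy
    have e := hE.unique hE2
    rw [hxy] at e
    have hl : (V 0).geodesic.line = γ.line := congrArg _ hΓ0
    change (⟨(V 0).geodesic.line, mfderiv 𝓘(ℝ, ℝ) (lineModel n)
      (fun t => (V t).geodesic.line) 0 (1 : ℝ)⟩ :
      TangentBundle (lineModel n) (OrientedGeodesic n)) = ⟨γ.line, X⟩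
    generalize mfderiv 𝓘(ℝ, ℝ) (lineModel n) (fun t => (V t).geodesic.line) 0 (1 : ℝ) = X' at e ⊢
    clear hE hE2
    revert X'
    rw [hl]
    intro X' e
    rw [injective_mfderiv_endVec _ e]

/-- The number `|J|² - |J'|²` is constant along the geodesic and depends only on `X = T_γ(J)`. -/
theorem existsUnique_sqNorm (X : TangentBundle (lineModel n) (OrientedGeodesic n)) :
    ∃! r : ℝ, ∃ Γ, IsVariation Γ X ∧ ∀ s, jacobiNorm Γ s = r := by
  obtain ⟨Γ, h⟩ := exists_isVariation X
  refine ⟨_, ⟨Γ, h, fun s => h.jacobiNorm_eq_pairNorm s⟩, ?_⟩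
  rintro r ⟨Γ', h', hr⟩
  rw [← hr 0, h'.jacobiNorm_eq_pairNorm]

/-- The square norm of the canonical split semi-Riemannian metric `g` of the space of oriented
geodesics (induced by the Killing form): `‖T_γ(J)‖ = |J|² - |J'|²` for `J` a Jacobi field along
`γ` orthogonal to `γ'`. -/
def sqNorm (X : TangentBundle (lineModel n) (OrientedGeodesic n)) : ℝ :=
  Classical.choose (existsUnique_sqNorm X).exists

lemma IsVariation.sqNorm_eq {Γ : ℝ → UnitGeodesic n}
    {X : TangentBundle (lineModel n) (OrientedGeodesic n)} (h : IsVariation Γ X) (s : ℝ) :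
    sqNorm X = jacobiNorm Γ s :=
  (existsUnique_sqNorm X).unique (Classical.choose_spec (existsUnique_sqNorm X).exists)
    ⟨Γ, h, fun t => by rw [h.jacobiNorm_eq_pairNorm, h.jacobiNorm_eq_pairNorm]⟩

/-- `F` is an isometry onto `(S^n × S^n) - Δ` with the metric given by `pairNorm`. -/
lemma sqNorm_eq_pairNorm (X : TangentBundle (lineModel n) (OrientedGeodesic n)) :
    sqNorm X = pairNorm (endVec X.proj).1 (endVec X.proj).2
      (mvfderiv (lineModel n) (endVec (n := n)) X.proj X.snd).1
      (mvfderiv (lineModel n) (endVec (n := n)) X.proj X.snd).2 := by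
  obtain ⟨Γ, h⟩ := exists_isVariation X
  rw [h.sqNorm_eq 0, h.jacobiNorm_eq_pairNorm]

end Metric3

/-! ### Hypersurfaces of hyperbolic space -/

section Hypersurface
variable {n : ℕ} {S : Type*} [TopologicalSpace S] [ChartedSpace (EuclideanSpace ℝ (Fin n)) S]

/-- The `n`-manifold `S` is a submanifold of codimension one of the hyperbolic space of dimension
`n + 1` with inclusion `ι` (an injective immersion). -/
structure IsHypersurface (ι : S → Mink n) : Prop where
  smooth : ContMDiff (𝓡 n) 𝓘(ℝ, Mink n) ∞ ι
  mem_hyperboloid : ∀ q, ι q ∈ hyperboloid n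
  injective : Function.Injective ι
  immersion : ∀ q, Function.Injective (mvfderiv (𝓡 n) ι q)

/-- The square norm of a tangent vector of `S` for the Riemannian metric induced by the inclusion
`ι` in hyperbolic space. -/
def inducedSqNorm (ι : S → Mink n) (q : S) (w : TangentSpace (𝓡 n) q) : ℝ :=
  mink (mvfderiv (𝓡 n) ι q w) (mvfderiv (𝓡 n) ι q w)

/-- `x` is tangent to `S` at `q`. -/
def IsTangentAt (ι : S → Mink n) (q : S) (x : Mink n) : Prop :=
  ∃ w : TangentSpace (𝓡 n) q, mvfderiv (𝓡 n) ι q w = x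

/-- `S` is totally geodesic: its second fundamental form vanishes, that is, the covariant
derivative in hyperbolic space of a vector field `X` tangent to `S` along a curve `α` in `S` is
tangent to `S`. -/
def IsTotallyGeodesic (ι : S → Mink n) : Prop :=
  ∀ (a b : ℝ) (α : ℝ → S) (X : ℝ → Mink n),
    ContMDiffOn 𝓘(ℝ, ℝ) (𝓡 n) ∞ α (Set.Ioo a b) → ContDiffOn ℝ ∞ X (Set.Ioo a b) →
    (∀ t ∈ Set.Ioo a b, IsTangentAt ι (α t) (X t)) →
    ∀ t ∈ Set.Ioo a b, IsTangentAt ι (α t) (covDeriv (ι ∘ α) X t)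

/-- `α` is a geodesic of `S` for the induced metric: the component tangent to `S` of its
acceleration vanishes. -/
structure IsGeodesicIn (ι : S → Mink n) (α : ℝ → S) : Prop where
  smooth : ContMDiff 𝓘(ℝ, ℝ) (𝓡 n) ∞ α
  acceleration : ∀ t x, IsTangentAt ι (α t) x →
    mink (covDeriv (ι ∘ α) (deriv (ι ∘ α)) t) x = 0

/-- `S` is (geodesically) complete: every tangent vector of `S` is the initial velocity of a
geodesic of `S` which is defined on the whole line. -/
def IsCompleteHypersurface (ι : S → Mink n) : Prop :=
  ∀ (q : S) (w : TangentSpace (𝓡 n) q), ∃ α : ℝ → S, IsGeodesicIn ι α ∧ α 0 = q ∧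
    deriv (ι ∘ α) 0 = mvfderiv (𝓡 n) ι q w

/-- `V` is a smooth unit vector field of hyperbolic space along `S` which is normal to `S`. -/
structure IsUnitNormalField (ι V : S → Mink n) : Prop where
  smooth : ContMDiff (𝓡 n) 𝓘(ℝ, Mink n) ∞ V
  tangent : ∀ q, mink (ι q) (V q) = 0
  unit : ∀ q, mink (V q) (V q) = 1
  normal : ∀ q x, IsTangentAt ι q x → mink (V q) x = 0

/-- The map `φ : S → 𝓛`, `φ q = [γ_{V q}]`. -/
def normalLine {ι V : S → Mink n} (hS : IsHypersurface ι) (hV : IsUnitNormalField ι V) (q : S) :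
    OrientedGeodesic n :=
  UnitGeodesic.line (UnitTangent.geodesic
    ⟨ι q, V q, hS.mem_hyperboloid q, hV.tangent q, hV.unit q⟩)

end Hypersurface

end

end HypLines

open HypLines

/-! In the hyperboloid model the unit normal `V` is itself a vector of Minkowski space, and the
whole argument rests on its being constant. Differentiating `⟨ι, V⟩ = 0` and `⟨V, V⟩ = 1` shows that
`dV w` is orthogonal to `ι q` and to `V q`. Its pairing with tangent vectors is, up to sign, the
second fundamental form, which vanishes because `S` is totally geodesic. Since `ι q`, `V q` and the
tangent space span Minkowski space, `dV = 0` (`coordDeriv_normal_eq_zero`), and connectedness gives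
`V = e` for a fixed vector `e` (`normal_eq`). In particular `S` lies in the hyperplane orthogonal to
`e`.

The line `φ q` is encoded by the null vectors `ι q + V q` and `ι q - V q`, whose rays are its points
at infinity. As `dV = 0`, both vary with velocity `dι w`. In terms of null lifts whose velocities
satisfy the orthogonality conditions, the metric on pairs of points at infinity is the Lorentzian
product of the two velocities (`mink_eq_pairNorm`), here `⟨dι w, dι w⟩` (`sqNorm_normalLine`).
Equivalently, the Jacobi field is `J(s) = cosh s • dι w`, and `cosh² - sinh² = 1`. The Lorentzian
product is positive on the orthogonal complement of a point of hyperbolic space, so `φ` is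
space-like; a vector in the kernel of `dφ` would have norm zero, so `φ` is an immersion.

For the topology, `q` is recovered continuously from the points at infinity of `φ q`: pairing with
`e` fixes the scale of each null vector, and half the sum of the two is `ι q` (`footPoint`). This
reduces the claim to `ι` being an embedding (`isEmbedding_inclusion`). That holds because a point of
hyperbolic space orthogonal to `e` is determined by its component along one tangent space of `S`,
and this component is a local coordinate on `S`. -/

namespace HypLines

/-! ### Causal properties of the Lorentzian product -/

section Lorentz
variable {n : ℕ}

/-- The Lorentzian product is positive definite on the orthogonal complement of a point of
hyperbolic space. -/
lemma mink_self_pos {x u : Mink n} (hx : x ∈ hyperboloid n) (hxu : mink x u = 0) (hu : u ≠ 0) :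
    0 < mink u u := by
  have h1 := hx.1
  have h2 := hx.2
  have h3 := abs_real_inner_le_norm x.2 u.2
  simp only [mink, real_inner_self_eq_norm_sq] at h1 hxu ⊢
  rw [show inner ℝ x.2 u.2 = x.1 * u.1 by linarith] at h3
  have h4 : (x.1 * u.1) ^ 2 ≤ (‖x.2‖ * ‖u.2‖) ^ 2 := by
    rw [← sq_abs]; exact pow_le_pow_left₀ (abs_nonneg _) h3 2
  have h5 : ‖x.2‖ ^ 2 = x.1 ^ 2 - 1 := by nlinarith
  -- Cauchy–Schwarz now reads `x₁² u₁² ≤ (x₁² - 1) ‖u₂‖²`. If `u₂ = 0` this forces `u₁ = 0`;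
  -- otherwise `‖u₂‖² ≤ u₁²` would contradict it.
  rw [mul_pow, mul_pow, h5] at h4
  by_cases hz : u.2 = 0
  · exfalso
    rw [hz, norm_zero] at h4
    have : u.1 = 0 := by
      have : x.1 ^ 2 * u.1 ^ 2 = 0 := le_antisymm (by linarith) (by positivity)
      rcases mul_eq_zero.1 this with h | h
      · exact absurd (pow_eq_zero_iff two_ne_zero |>.1 h) h2.ne'
      · exact pow_eq_zero_iff two_ne_zero |>.1 h
    exact hu (Prod.ext this hz)
  · have h6 : 0 < ‖u.2‖ ^ 2 := by positivity
    have h7 : 0 < x.1 ^ 2 := by positivity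
    by_contra hneg
    have h8 : ‖u.2‖ ^ 2 ≤ u.1 ^ 2 := by linarith
    have h9 := mul_le_mul_of_nonneg_left h8 h7.le
    linarith

/-- On the upper sheet the time coordinate strictly dominates the spatial norm, so Cauchy–Schwarz
gives the sign. It later selects one of two square roots. -/
lemma mink_neg_of_mem {x y : Mink n} (hx : x ∈ hyperboloid n) (hy : y ∈ hyperboloid n) :
    mink x y < 0 := by
  have h1 := hx.1
  have h2 := hy.1
  have h3 := le_of_abs_le (abs_real_inner_le_norm x.2 y.2)
  simp only [mink, real_inner_self_eq_norm_sq] at h1 h2 ⊢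
  have h4 : ‖x.2‖ < x.1 := lt_of_pow_lt_pow_left₀ 2 hx.2.le (by linarith)
  have h5 : ‖y.2‖ < y.1 := lt_of_pow_lt_pow_left₀ 2 hy.2.le (by linarith)
  have h6 := mul_lt_mul'' h4 h5 (norm_nonneg _) (norm_nonneg _)
  linarith

lemma continuous_mink_left (y : Mink n) : Continuous fun x : Mink n => mink x y := by
  unfold mink; fun_prop

end Lorentz

/-! ### Differentials read in a chart -/

section Charts
variable {n : ℕ} {S : Type*} [TopologicalSpace S] [ChartedSpace (EuclideanSpace ℝ (Fin n)) S]
  {F : Type*} [NormedAddCommGroup F] [NormedSpace ℝ F]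

/-- The differential of a vector valued function, read in the preferred chart at `q`. -/
noncomputable def coordDeriv (n : ℕ) {S : Type*} [TopologicalSpace S]
    [ChartedSpace (EuclideanSpace ℝ (Fin n)) S] {F : Type*} [NormedAddCommGroup F] [NormedSpace ℝ F]
    (f : S → F) (q : S) : EuclideanSpace ℝ (Fin n) →L[ℝ] F :=
  mvfderiv (𝓡 n) f q

/-- The model has no boundary, so the derivative within the range of the model is a full derivative.
-/
lemma hasFDerivAt_comp_extChartAt_symm {f : S → F} (hf : ContMDiff (𝓡 n) 𝓘(ℝ, F) ∞ f) (q : S) :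
    HasFDerivAt (f ∘ (extChartAt (𝓡 n) q).symm) (coordDeriv n f q) (extChartAt (𝓡 n) q q) := by
  have h := ((hf q).mdifferentiableAt (by simp)).hasMFDerivAt.2
  simp only [modelWithCornersSelf_coe, Set.range_id] at h
  exact hasFDerivWithinAt_univ.1 h

/-- The curve is a straight segment in the chart at `q`. Identities on `S` are differentiated along
such curves below. -/
lemma hasDerivAt_comp_extChartAt_symm {f : S → F} (hf : ContMDiff (𝓡 n) 𝓘(ℝ, F) ∞ f) (q : S)
    (w : EuclideanSpace ℝ (Fin n)) :
    HasDerivAt (fun t : ℝ => f ((extChartAt (𝓡 n) q).symm (extChartAt (𝓡 n) q q + t • w)))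
      (coordDeriv n f q w) 0 := by
  have h : HasDerivAt (fun t : ℝ => extChartAt (𝓡 n) q q + t • w) w 0 := by
    have := ((hasDerivAt_id (0 : ℝ)).smul_const w).const_add (extChartAt (𝓡 n) q q)
    rwa [one_smul] at this
  exact (hasFDerivAt_comp_extChartAt_symm hf q).comp_hasDerivAt_of_eq (0 : ℝ) h (by simp)

variable [IsManifold (𝓡 n) ∞ S]

lemma contDiffOn_comp_extChartAt_symm {f : S → F} (hf : ContMDiff (𝓡 n) 𝓘(ℝ, F) ∞ f) (q : S) :
    ContDiffOn ℝ ∞ (f ∘ (extChartAt (𝓡 n) q).symm) (extChartAt (𝓡 n) q).target :=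
  (hf.comp_contMDiffOn (contMDiffOn_extChartAt_symm q)).contDiffOn

/-- Chain rule away from the centre of the chart. It shows that coordinate derivatives of `ι` are
tangent to `S` at the moving point, not only at `q`. -/
lemma fderiv_comp_extChartAt_symm {f : S → F} (hf : ContMDiff (𝓡 n) 𝓘(ℝ, F) ∞ f) (q : S)
    {x : EuclideanSpace ℝ (Fin n)} (hx : x ∈ (extChartAt (𝓡 n) q).target)
    (u : EuclideanSpace ℝ (Fin n)) :
    fderiv ℝ (f ∘ (extChartAt (𝓡 n) q).symm) x u =
      mvfderiv (𝓡 n) f ((extChartAt (𝓡 n) q).symm x)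
        (mfderiv 𝓘(ℝ, EuclideanSpace ℝ (Fin n)) (𝓡 n) (extChartAt (𝓡 n) q).symm x u) := by
  have h1 : MDifferentiableAt 𝓘(ℝ, EuclideanSpace ℝ (Fin n)) (𝓡 n)
      (extChartAt (𝓡 n) q).symm x :=
    ((contMDiffOn_extChartAt_symm (n := ∞) q).contMDiffAt
      ((isOpen_extChartAt_target q).mem_nhds hx)).mdifferentiableAt (by simp)
  have h2 := ((hf _).mdifferentiableAt (by simp)).hasMFDerivAt.comp x h1.hasMFDerivAt
  have h3 : HasFDerivAt (𝕜 := ℝ) (E := EuclideanSpace ℝ (Fin n)) (F := F)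
      (f ∘ (extChartAt (𝓡 n) q).symm) _ x := h2.hasFDerivAt
  exact DFunLike.congr_fun h3.fderiv u

/-- Strict differentiability is the form that the inverse function theorem needs. -/
lemma hasStrictFDerivAt_comp_extChartAt_symm {f : S → F} (hf : ContMDiff (𝓡 n) 𝓘(ℝ, F) ∞ f)
    (q : S) :
    HasStrictFDerivAt (f ∘ (extChartAt (𝓡 n) q).symm) (coordDeriv n f q)
      (extChartAt (𝓡 n) q q) := by
  have h := ((contDiffOn_comp_extChartAt_symm hf q).contDiffAt
    (extChartAt_target_mem_nhds q)).hasStrictFDerivAt (by simp)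
  rwa [(hasFDerivAt_comp_extChartAt_symm hf q).fderiv] at h

/-- A smooth function with vanishing differential on a connected manifold is constant. -/
lemma eq_of_coordDeriv_eq_zero [PreconnectedSpace S] {f : S → F}
    (hf : ContMDiff (𝓡 n) 𝓘(ℝ, F) ∞ f) (h0 : ∀ q, coordDeriv n f q = 0) (p q : S) : f p = f q := by
  have hloc : IsLocallyConstant f := by
    rw [IsLocallyConstant.iff_eventually_eq]
    intro q
    -- A coordinate ball is convex, so vanishing of the derivative on it gives local constancy.
    obtain ⟨r, hr, hb⟩ := Metric.mem_nhds_iff.1 (extChartAt_target_mem_nhds (I := 𝓡 n) q)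
    have hd := (contDiffOn_comp_extChartAt_symm hf q).differentiableOn (by simp)
    filter_upwards [(continuousAt_extChartAt (I := 𝓡 n) q).preimage_mem_nhds
      (Metric.ball_mem_nhds _ hr), extChartAt_source_mem_nhds (I := 𝓡 n) q] with y hy hys
    have := Metric.isOpen_ball.is_const_of_fderiv_eq_zero
      (convex_ball (extChartAt (𝓡 n) q q) r).isPreconnected (hd.mono hb) (fun x hx => by
        have h := h0 ((extChartAt (𝓡 n) q).symm x)
        rw [coordDeriv] at h
        ext1 w
        rw [fderiv_comp_extChartAt_symm hf q (hb hx)]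
        exact DFunLike.congr_fun h _) hy (Metric.mem_ball_self hr)
    rwa [Function.comp_apply, Function.comp_apply, (extChartAt (𝓡 n) q).left_inv hys,
      extChartAt_to_inv] at this
  exact hloc.apply_eq_of_isPreconnected isPreconnected_univ trivial trivial

end Charts

/-! ### The moving frame along a hypersurface -/

section Normal
variable {n : ℕ} {S : Type*} [TopologicalSpace S] [ChartedSpace (EuclideanSpace ℝ (Fin n)) S]
  {ι V : S → Mink n}

lemma IsHypersurface.coordDeriv_injective (hS : IsHypersurface ι) (q : S) :
    Function.Injective (coordDeriv n ι q) := hS.immersion q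

lemma IsUnitNormalField.mink_coordDeriv (hV : IsUnitNormalField ι V) (q : S)
    (w : EuclideanSpace ℝ (Fin n)) : mink (V q) (coordDeriv n ι q w) = 0 :=
  hV.normal q _ ⟨w, rfl⟩

/-- Differentiate `⟨ι, ι⟩ = -1`. -/
lemma IsHypersurface.mink_coordDeriv (hS : IsHypersurface ι) (q : S)
    (w : EuclideanSpace ℝ (Fin n)) : mink (ι q) (coordDeriv n ι q w) = 0 := by
  have h3 := hasDerivAt_comp_extChartAt_symm hS.smooth q w
  have h4 := hasDerivAt_mink h3 h3
  simp only [(hS.mem_hyperboloid _).1] at h4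
  have h5 := h4.unique (hasDerivAt_const 0 (-1 : ℝ))
  simp only [zero_smul, add_zero, extChartAt_to_inv] at h5
  rw [mink_comm (coordDeriv n ι q w)] at h5
  linarith

/-- The tangent space, the position vector and the unit normal vector span Minkowski space. -/
lemma exists_eq_add (hS : IsHypersurface ι) (hV : IsUnitNormalField ι V) (q : S) :
    ∃ L : Mink n →L[ℝ] EuclideanSpace ℝ (Fin n), (∀ w, L (coordDeriv n ι q w) = w) ∧
      ∀ x, x = coordDeriv n ι q (L x) + ((-mink x (ι q)) • ι q + mink x (V q) • V q) := by
  have hι := (hS.mem_hyperboloid q).1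
  have hVι : mink (V q) (ι q) = 0 := by rw [mink_comm, hV.tangent]
  have h1 : ∀ w, mink (coordDeriv n ι q w) (ι q) = 0 := fun w => by
    rw [mink_comm, hS.mink_coordDeriv]
  have h2 : ∀ w, mink (coordDeriv n ι q w) (V q) = 0 := fun w => by
    rw [mink_comm, hV.mink_coordDeriv]
  let f : (EuclideanSpace ℝ (Fin n) × ℝ × ℝ) →ₗ[ℝ] Mink n :=
    (coordDeriv n ι q).toLinearMap.coprod ((LinearMap.toSpanSingleton ℝ (Mink n) (ι q)).coprod
      (LinearMap.toSpanSingleton ℝ (Mink n) (V q)))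
  have hf : ∀ w a b, f (w, a, b) = coordDeriv n ι q w + (a • ι q + b • V q) := fun w a b => rfl
  -- The three summands are mutually orthogonal, so pairing recovers the two scalar coefficients;
  -- immersivity then gives injectivity.
  have m1 : ∀ w a b, mink (f (w, a, b)) (ι q) = -a := fun w a b => by
    simp only [hf, mink_add_left, mink_smul_left, h1, hι, hVι]; ring
  have m2 : ∀ w a b, mink (f (w, a, b)) (V q) = b := fun w a b => by
    simp only [hf, mink_add_left, mink_smul_left, h2, hV.tangent, hV.unit]; ring
  have hinj : Function.Injective f := by
    rintro ⟨w, a, b⟩ ⟨w', a', b'⟩ h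
    have ha : a = a' := neg_injective (by rw [← m1 w a b, ← m1 w' a' b', h])
    have hb : b = b' := by rw [← m2 w a b, ← m2 w' a' b', h]
    subst ha hb
    rw [hf, hf, add_left_inj] at h
    rw [hS.coordDeriv_injective q h]
  -- Both sides have dimension `n + 2`. The map `L` is the first component of the inverse.
  let e := LinearEquiv.ofInjectiveOfFinrankEq f hinj (by simp; ring)
  have he : ∀ y, e y = f y := fun y => rfl
  refine ⟨((LinearMap.fst ℝ _ _).comp e.symm.toLinearMap).toContinuousLinearMap, fun w => ?_,
    fun x => ?_⟩
  · have : coordDeriv n ι q w = e (w, 0, 0) := by simp [he, hf]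
    simp [this]
  · obtain ⟨⟨w, a, b⟩, rfl⟩ := e.surjective x
    simp only [LinearMap.coe_toContinuousLinearMap', LinearMap.coe_comp,
      LinearEquiv.coe_coe, Function.comp_apply, LinearEquiv.symm_apply_apply, LinearMap.fst_apply]
    rw [he, m1, m2, neg_neg, hf]

/-- A vector which is orthogonal to the tangent space, the position vector and the unit normal
vector vanishes. -/
lemma eq_zero_of_mink_eq_zero (hS : IsHypersurface ι) (hV : IsUnitNormalField ι V) {q : S}
    {x : Mink n} (h1 : mink x (ι q) = 0) (h2 : mink x (V q) = 0)
    (h3 : ∀ w, mink x (coordDeriv n ι q w) = 0) : x = 0 := by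
  by_contra hx
  -- The decomposition makes `x` itself tangent, hence orthogonal to itself, while a nonzero vector
  -- orthogonal to `ι q` has positive square.
  have hpos := mink_self_pos (hS.mem_hyperboloid q) (by rwa [mink_comm]) hx
  obtain ⟨L, -, hL⟩ := exists_eq_add hS hV q
  have h := hL x
  rw [h1, h2, neg_zero, zero_smul, zero_smul, add_zero, add_zero] at h
  have h4 := h3 (L x)
  rw [← h] at h4
  exact hpos.ne' h4

lemma inducedSqNorm_pos (hS : IsHypersurface ι) {q : S} {w : TangentSpace (𝓡 n) q} (hw : w ≠ 0) :
    0 < inducedSqNorm ι q w :=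
  mink_self_pos (hS.mem_hyperboloid q) (hS.mink_coordDeriv q w) fun h =>
    hw (hS.immersion q (h.trans (map_zero _).symm))

end Normal

/-! ### Totally geodesic hypersurfaces: constant normal and embeddedness -/

section TotallyGeodesic
variable {n : ℕ} {S : Type*} [TopologicalSpace S] [ChartedSpace (EuclideanSpace ℝ (Fin n)) S]
  [IsManifold (𝓡 n) ∞ S] {ι V : S → Mink n}

/-- The second fundamental form of a totally geodesic hypersurface vanishes: the derivative of the
unit normal field has no tangential component. -/
lemma mink_coordDeriv_normal (hS : IsHypersurface ι) (hgeodesic : IsTotallyGeodesic ι)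
    (hV : IsUnitNormalField ι V) (q : S) (w u : EuclideanSpace ℝ (Fin n)) :
    mink (coordDeriv n V q w) (coordDeriv n ι q u) = 0 := by
  set ψ := extChartAt (𝓡 n) q with hψ
  set c : ℝ → EuclideanSpace ℝ (Fin n) := fun t => ψ q + t • w with hc
  have cc : ContDiff ℝ ∞ c := by fun_prop
  have c0 : c 0 = ψ q := by simp [hc]
  have hmem : ∀ᶠ t in nhds (0 : ℝ), c t ∈ ψ.target :=
    cc.continuous.continuousAt.eventually_mem (by rw [c0]; exact extChartAt_target_mem_nhds q)
  -- The segment stays in the chart only for small times, so total geodesy is applied on an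
  -- interval.
  obtain ⟨ε, hε, hball⟩ := Metric.eventually_nhds_iff_ball.1 hmem
  rw [Real.ball_eq_Ioo, zero_sub, zero_add] at hball
  have h0 : (0 : ℝ) ∈ Set.Ioo (-ε) ε := by simp [hε]
  -- The coordinate field in the constant direction `u`: a smooth tangent field along the curve
  -- whose value at time `0` is `dι u`.
  set X : ℝ → Mink n := fun t => fderiv ℝ (ι ∘ ψ.symm) (c t) u with hX
  have hXt : ∀ t ∈ Set.Ioo (-ε) ε, IsTangentAt ι (ψ.symm (c t)) (X t) := fun t ht => by
    exact ⟨_, (fderiv_comp_extChartAt_symm hS.smooth q (hball t ht) u).symm⟩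
  have hXs : ContDiffOn ℝ ∞ X (Set.Ioo (-ε) ε) := by
    have h := (contDiffOn_comp_extChartAt_symm hS.smooth q).fderiv_of_isOpen
      (isOpen_extChartAt_target q) (m := ∞) (by simp)
    exact (h.comp cc.contDiffOn hball).clm_apply contDiffOn_const
  have hα : ContMDiffOn 𝓘(ℝ, ℝ) (𝓡 n) ∞ (fun t => ψ.symm (c t)) (Set.Ioo (-ε) ε) :=
    (contMDiffOn_extChartAt_symm q).comp cc.contMDiff.contMDiffOn hball
  have hα0 : ψ.symm (c 0) = q := by rw [c0, hψ, extChartAt_to_inv]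
  have h1 := hgeodesic (-ε) ε _ X hα hXs hXt 0 h0
  have h2 := hV.normal _ _ h1
  have hX0 : X 0 = coordDeriv n ι q u := by
    simp only [hX, c0]
    rw [(hasFDerivAt_comp_extChartAt_symm hS.smooth q).fderiv]
  have hXd : HasDerivAt X (deriv X 0) 0 :=
    ((hXs.differentiableOn (by simp)).differentiableAt
      (Ioo_mem_nhds h0.1 h0.2)).hasDerivAt
  -- Differentiating `⟨V, X⟩ = 0` turns the claim into `⟨V, X'⟩ = 0`.
  have h3 := hasDerivAt_mink (hasDerivAt_comp_extChartAt_symm hV.smooth q w) hXd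
  have h4 : (fun t => mink (V (ψ.symm (c t))) (X t)) =ᶠ[nhds 0] fun _ => (0 : ℝ) := by
    filter_upwards [Ioo_mem_nhds h0.1 h0.2] with t ht
    exact hV.normal _ _ (hXt t ht)
  have h5 := h3.unique ((hasDerivAt_const (0 : ℝ) (0 : ℝ)).congr_of_eventuallyEq h4)
  change mink (V (ψ.symm (c 0))) (deriv X 0) + _ = 0 at h5
  rw [hα0, hX0] at h5
  -- The covariant and ambient derivatives differ by a multiple of `ι q`, which `V q` does not see.
  rw [covDeriv, mink_add_right, mink_smul_right] at h2
  simp only [Function.comp_apply] at h2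
  rw [hα0, mink_comm (V q) (ι q), hV.tangent, mul_zero, add_zero] at h2
  linarith

/-- The unit normal field of a totally geodesic hypersurface is parallel in Minkowski space. -/
lemma coordDeriv_normal_eq_zero (hS : IsHypersurface ι) (hgeodesic : IsTotallyGeodesic ι)
    (hV : IsUnitNormalField ι V) (q : S) : coordDeriv n V q = 0 := by
  ext1 w
  have hVd := hasDerivAt_comp_extChartAt_symm hV.smooth q w
  refine eq_zero_of_mink_eq_zero hS hV ?_ ?_ (mink_coordDeriv_normal hS hgeodesic hV q w)
  -- From `⟨ι, V⟩ = 0`, using that `V` is normal to `dι w`; the next case comes from `⟨V, V⟩ = 1`.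
  · have h := hasDerivAt_mink (hasDerivAt_comp_extChartAt_symm hS.smooth q w) hVd
    simp only [hV.tangent] at h
    have h5 := h.unique (hasDerivAt_const 0 (0 : ℝ))
    simp only [zero_smul, add_zero, extChartAt_to_inv] at h5
    rw [mink_comm (coordDeriv n ι q w), hV.mink_coordDeriv, add_zero] at h5
    rw [mink_comm, h5]
  · have h := hasDerivAt_mink hVd hVd
    simp only [hV.unit] at h
    have h5 := h.unique (hasDerivAt_const 0 (1 : ℝ))
    simp only [zero_smul, add_zero, extChartAt_to_inv] at h5
    rw [mink_comm (V q)] at h5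
    linarith

lemma normal_eq [PreconnectedSpace S] (hS : IsHypersurface ι) (hgeodesic : IsTotallyGeodesic ι)
    (hV : IsUnitNormalField ι V) (p q : S) : V p = V q :=
  eq_of_coordDeriv_eq_zero hV.smooth (coordDeriv_normal_eq_zero hS hgeodesic hV) p q

/-- A connected totally geodesic hypersurface with a unit normal field is embedded. -/
lemma isEmbedding_inclusion [PreconnectedSpace S] (hS : IsHypersurface ι)
    (hgeodesic : IsTotallyGeodesic ι) (hV : IsUnitNormalField ι V) : Topology.IsEmbedding ι := by
  refine ⟨Topology.isInducing_iff_nhds.2 fun q => le_antisymm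
    (hS.smooth.continuous.tendsto q).le_comap fun U hU => ?_, hS.injective⟩
  obtain ⟨L, hL1, hL⟩ := exists_eq_add hS hV q
  -- In the chart, `L ∘ ι` has the identity as derivative at `q`, so by the inverse function theorem
  -- it carries neighbourhoods to neighbourhoods.
  have hstrict : HasStrictFDerivAt (L ∘ ι ∘ (extChartAt (𝓡 n) q).symm)
      (ContinuousLinearEquiv.refl ℝ (EuclideanSpace ℝ (Fin n)) :
        EuclideanSpace ℝ (Fin n) →L[ℝ] EuclideanSpace ℝ (Fin n)) (extChartAt (𝓡 n) q q) := by
    have h := L.hasStrictFDerivAt.comp _ (hasStrictFDerivAt_comp_extChartAt_symm hS.smooth q)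
    have e : L.comp (coordDeriv n ι q) = (ContinuousLinearEquiv.refl ℝ (EuclideanSpace ℝ (Fin n)) :
        EuclideanSpace ℝ (Fin n) →L[ℝ] EuclideanSpace ℝ (Fin n)) := by ext1 w; exact hL1 w
    rwa [e] at h
  have hmap := hstrict.map_nhds_eq_of_equiv
  have hU' : (extChartAt (𝓡 n) q).symm ⁻¹' U ∈ nhds (extChartAt (𝓡 n) q q) :=
    (continuousAt_extChartAt_symm q).preimage_mem_nhds (by rwa [extChartAt_to_inv])
  have himg := Filter.image_mem_map (m := L ∘ ι ∘ (extChartAt (𝓡 n) q).symm) hU'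
  rw [hmap] at himg
  simp only [Function.comp_apply, extChartAt_to_inv] at himg
  -- The neighbourhood of `ι q` is the preimage under `L` of the image of `U`. It remains to see
  -- that `L ∘ ι` is injective on all of `S`, so that no distant sheet of `S` returns near `ι q`.
  refine ⟨_, L.continuous.continuousAt.preimage_mem_nhds himg, ?_⟩
  rintro p ⟨x, hx, hxp⟩
  simp only at hxp
  suffices h : ι ((extChartAt (𝓡 n) q).symm x) = ι p by
    rw [← hS.injective h]; exact hx
  generalize (extChartAt (𝓡 n) q).symm x = y at hxp
  -- The normal component vanishes because `V q = V z` is orthogonal to `ι z`.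
  have hdecomp : ∀ z, ι z = coordDeriv n ι q (L (ι z)) + (-mink (ι z) (ι q)) • ι q := fun z => by
    have h := hL (ι z)
    rwa [normal_eq hS hgeodesic hV q z, hV.tangent, zero_smul, add_zero] at h
  have hsq : ∀ z, mink (coordDeriv n ι q (L (ι z))) (coordDeriv n ι q (L (ι z))) -
      mink (ι z) (ι q) ^ 2 = -1 := fun z => by
    have h := (hS.mem_hyperboloid z).1
    rw [hdecomp z] at h
    simp only [mink_add_left, mink_add_right, mink_smul_left, mink_smul_right,
      (hS.mem_hyperboloid q).1, hS.mink_coordDeriv, mink_comm _ (ι q)] at h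
    rw [mink_comm _ (ι q)]
    linarith
  have hy := hsq y
  rw [hxp, ← hsq p, sub_right_inj] at hy
  -- The hyperboloid equation gives the coefficient of `ι q` up to sign; both points lie on the
  -- upper sheet, which fixes the sign.
  have ha : mink (ι y) (ι q) = mink (ι p) (ι q) := by
    rcases sq_eq_sq_iff_eq_or_eq_neg.1 hy with h | h
    · exact h
    · have h1 := mink_neg_of_mem (hS.mem_hyperboloid y) (hS.mem_hyperboloid q)
      have h2 := mink_neg_of_mem (hS.mem_hyperboloid p) (hS.mem_hyperboloid q)
      linarith
  rw [hdecomp y, hdecomp p, hxp, ha]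

end TotallyGeodesic

/-! ### The normal map and its induced metric -/

section NormalLine
variable {n : ℕ} {S : Type*} [TopologicalSpace S] [ChartedSpace (EuclideanSpace ℝ (Fin n)) S]
  {ι V : S → Mink n}

/-- The normal field as a map to the unit tangent bundle of hyperbolic space. -/
def normalVector (hS : IsHypersurface ι) (hV : IsUnitNormalField ι V) (q : S) : UnitTangent n :=
  ⟨ι q, V q, hS.mem_hyperboloid q, hV.tangent q, hV.unit q⟩

lemma endVec_normalLine (hS : IsHypersurface ι) (hV : IsUnitNormalField ι V) (q : S) :
    endVec (normalLine hS hV q) =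
      (ray (normalVector hS hV q).bwd, ray (normalVector hS hV q).fwd) := by
  have h : ((normalLine hS hV q).ends : SphereInf n × SphereInf n) = (normalVector hS hV q).ends :=
    (normalVector hS hV q).ends_geodesic_line
  rw [endVec, h]; rfl

lemma continuous_endVec : Continuous (endVec (n := n)) := contMDiff_endVec.continuous

lemma contMDiff_normalLine [IsManifold (𝓡 n) ∞ S] (hS : IsHypersurface ι)
    (hV : IsUnitNormalField ι V) : ContMDiff (𝓡 n) (lineModel n) ∞ (normalLine hS hV) := by
  have hvel : ∀ q, ((normalVector hS hV q).geodesic).velocity 0 = normalVector hS hV q := fun q =>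
    UnitTangent.ext (UnitTangent.geodesic_zero _)
      (by simp [UnitGeodesic.velocity, UnitTangent.deriv_geodesic])
  refine contMDiff_line (G := fun q => (normalVector hS hV q).geodesic) ?_ ?_
  · simp only [hvel]; exact hS.smooth
  · simp only [hvel]; exact hV.smooth

/-- Links the intrinsic differential of `φ` to the motion of the points at infinity along an
explicit curve, where it can be computed. -/
lemma hasDerivAt_endVec_normalLine [IsManifold (𝓡 n) ∞ S] (hS : IsHypersurface ι)
    (hV : IsUnitNormalField ι V) (q : S) (w : EuclideanSpace ℝ (Fin n)) :
    HasDerivAt (fun t : ℝ => endVec (normalLine hS hV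
        ((extChartAt (𝓡 n) q).symm (extChartAt (𝓡 n) q q + t • w))))
      (mvfderiv (lineModel n) (endVec (n := n)) (normalLine hS hV q)
        (mfderiv (𝓡 n) (lineModel n) (normalLine hS hV) q w)) 0 := by
  have hφ := contMDiff_normalLine hS hV
  have h := hasDerivAt_comp_extChartAt_symm (contMDiff_endVec.comp hφ) q w
  have h1 := (mdifferentiable_endVec (normalLine hS hV q)).hasMFDerivAt.comp q
    ((hφ q).mdifferentiableAt (by simp)).hasMFDerivAt
  refine h.congr_deriv ?_
  exact DFunLike.congr_fun h1.mfderiv w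

/-- The metric induced by the normal map of a hypersurface whose unit normal field is parallel
in Minkowski space. -/
lemma sqNorm_normalLine [IsManifold (𝓡 n) ∞ S] (hS : IsHypersurface ι)
    (hV : IsUnitNormalField ι V) {q : S} (h0 : coordDeriv n V q = 0)
    (w : EuclideanSpace ℝ (Fin n)) :
    sqNorm ⟨normalLine hS hV q, mfderiv (𝓡 n) (lineModel n) (normalLine hS hV) q w⟩ =
      inducedSqNorm ι q w := by
  rw [sqNorm_eq_pairNorm]
  have hE := hasDerivAt_endVec_normalLine hS hV q w
  obtain ⟨i1, i2⟩ := inner_mvfderiv_endVec (normalLine hS hV q)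
    (mfderiv (𝓡 n) (lineModel n) (normalLine hS hV) q w)
  generalize mvfderiv (lineModel n) (endVec (n := n)) (normalLine hS hV q)
    (mfderiv (𝓡 n) (lineModel n) (normalLine hS hV) q w) = xy at *
  obtain ⟨x, y⟩ := xy
  simp only [endVec_normalLine] at hE i1 i2 ⊢
  set v := normalVector hS hV with hv
  have dι := hasDerivAt_comp_extChartAt_symm hS.smooth q w
  have dV := hasDerivAt_comp_extChartAt_symm hV.smooth q w
  rw [h0] at dV
  have hx : HasDerivAt (fun t : ℝ => ray (v
      ((extChartAt (𝓡 n) q).symm (extChartAt (𝓡 n) q q + t • w))).bwd) x 0 := by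
    have := hE.hasFDerivAt.fst.hasDerivAt; simpa using this
  have hy : HasDerivAt (fun t : ℝ => ray (v
      ((extChartAt (𝓡 n) q).symm (extChartAt (𝓡 n) q q + t • w))).fwd) y 0 := by
    have := hE.hasFDerivAt.snd.hasDerivAt; simpa using this
  -- With `dV = 0`, the null vectors `ι + V` and `ι - V` have the same velocity `dι w`.
  have hU : HasDerivAt (fun t : ℝ => (v
      ((extChartAt (𝓡 n) q).symm (extChartAt (𝓡 n) q q + t • w))).fwd) (coordDeriv n ι q w) 0 :=
    (dι.add dV).congr_deriv (by simp)
  have hW : HasDerivAt (fun t : ℝ => (v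
      ((extChartAt (𝓡 n) q).symm (extChartAt (𝓡 n) q q + t • w))).bwd) (coordDeriv n ι q w) 0 :=
    (dι.sub dV).congr_deriv (by simp)
  have ex := hx.unique (hasDerivAt_ray hW (v _).bwd_pos)
  have ey := hy.unique (hasDerivAt_ray hU (v _).fwd_pos)
  simp only [zero_smul, add_zero, extChartAt_to_inv] at ex ey
  have t1 : mink (coordDeriv n ι q w) (v q).bwd = 0 := by
    have : (v q).bwd = ι q - V q := rfl
    rw [this, mink_sub_right, mink_comm, hS.mink_coordDeriv, mink_comm, hV.mink_coordDeriv, sub_zero]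
  have t2 : mink (coordDeriv n ι q w) (v q).fwd = 0 := by
    have : (v q).fwd = ι q + V q := rfl
    rw [this, mink_add_right, mink_comm, hS.mink_coordDeriv, mink_comm, hV.mink_coordDeriv, add_zero]
  change _ = mink (coordDeriv n ι q w) (coordDeriv n ι q w)
  generalize coordDeriv n ι q w = U at *
  -- Leibniz rule for `u = u.1 • (1, ray u)`, with `y` the velocity of the ray.
  have key : ∀ (u u' : Mink n) (y : EuclideanSpace ℝ (Fin (n + 1))), 0 < u.1 →
      y = u.1⁻¹ • (u'.2 - u'.1 • ray u) → u' = u'.1 • ((1 : ℝ), ray u) + u.1 • ((0 : ℝ), y) := by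
    rintro u u' y hu rfl
    ext1
    · simp
    · simp [smul_smul, hu.ne']
  have kU := key _ _ _ (v q).fwd_pos ey
  have kW := key _ _ _ (v q).bwd_pos ex
  have huw := (v q).fwd_bwd
  rw [eq_smul_ray (v q).fwd_pos, eq_smul_ray (v q).bwd_pos] at huw
  have hu : mink (U.1 • ((1 : ℝ), ray (v q).fwd) + (v q).fwd.1 • ((0 : ℝ), y))
      ((v q).bwd.1 • ((1 : ℝ), ray (v q).bwd)) = 0 := by
    rw [← kU, ← eq_smul_ray (v q).bwd_pos, t1]
  have hw : mink (U.1 • ((1 : ℝ), ray (v q).bwd) + (v q).bwd.1 • ((0 : ℝ), x))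
      ((v q).fwd.1 • ((1 : ℝ), ray (v q).fwd)) = 0 := by
    rw [← kW, ← eq_smul_ray (v q).fwd_pos, t2]
  -- Both null lifts have velocity `U = dι w`, so the norm on pairs of points at infinity becomes
  -- `⟨U, U⟩`.
  have h := mink_eq_pairNorm (v q).ends.1 (v q).ends.2 (v q).ends_ne x y _ _ _ _ huw i1 i2 hu hw
  refine h.symm.trans ?_
  change mink (U.1 • ((1 : ℝ), ray (v q).fwd) + (v q).fwd.1 • ((0 : ℝ), y))
    (U.1 • ((1 : ℝ), ray (v q).bwd) + (v q).bwd.1 • ((0 : ℝ), x)) = _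
  rw [← kU, ← kW]

lemma sqNorm_zero (ℓ : OrientedGeodesic n) :
    sqNorm (⟨ℓ, 0⟩ : TangentBundle (lineModel n) (OrientedGeodesic n)) = 0 := by
  rw [sqNorm_eq_pairNorm, map_zero]
  simp [pairNorm]

/-! ### Recovering the base point from the points at infinity -/

/-- The foot on the hyperplane orthogonal to `e` of the geodesic with points at infinity `z.1`
and `z.2`, provided that it is orthogonal to that hyperplane. -/
noncomputable def footPoint (e : Mink n)
    (z : EuclideanSpace ℝ (Fin (n + 1)) × EuclideanSpace ℝ (Fin (n + 1))) : Mink n :=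
  (1 / 2 : ℝ) • ((mink ((1 : ℝ), z.2) e)⁻¹ • ((1 : ℝ), z.2) -
    (mink ((1 : ℝ), z.1) e)⁻¹ • ((1 : ℝ), z.1))

/-- A ray determines its null vector only up to scale; `⟨v.fwd, v.vec⟩ = 1` fixes that scale once
`v.vec` is known. -/
lemma UnitTangent.mink_fwd_vec (v : UnitTangent n) :
    v.fwd.1 * mink ((1 : ℝ), ray v.fwd) v.vec = 1 := by
  rw [← mink_smul_left, ← eq_smul_ray v.fwd_pos, fwd, mink_add_left, v.tangent, v.unit, zero_add]

lemma UnitTangent.mink_bwd_vec (v : UnitTangent n) :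
    v.bwd.1 * mink ((1 : ℝ), ray v.bwd) v.vec = -1 := by
  rw [← mink_smul_left, ← eq_smul_ray v.bwd_pos, bwd, mink_sub_left, v.tangent, v.unit, zero_sub]

/-- The base point is half the sum of the two null vectors. The minus sign in `footPoint`
compensates for `⟨v.bwd, v.vec⟩ = -1`. -/
lemma UnitTangent.footPoint_ray (v : UnitTangent n) :
    footPoint v.vec (ray v.bwd, ray v.fwd) = v.pt := by
  have h1 := v.mink_fwd_vec
  have h2 := v.mink_bwd_vec
  have e1 : (mink ((1 : ℝ), ray v.fwd) v.vec)⁻¹ = v.fwd.1 := (eq_inv_of_mul_eq_one_left h1).symm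
  have e2 : (mink ((1 : ℝ), ray v.bwd) v.vec)⁻¹ = -v.bwd.1 :=
    (eq_inv_of_mul_eq_one_left (by linarith)).symm
  rw [footPoint, e1, e2, neg_smul, sub_neg_eq_add, ← eq_smul_ray v.fwd_pos,
    ← eq_smul_ray v.bwd_pos]
  simp only [fwd, bwd]; module

lemma UnitTangent.continuousAt_footPoint (v : UnitTangent n) :
    ContinuousAt (footPoint v.vec) (ray v.bwd, ray v.fwd) := by
  have h1 : mink ((1 : ℝ), ray v.fwd) v.vec ≠ 0 := right_ne_zero_of_mul_eq_one v.mink_fwd_vec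
  have h2 : mink ((1 : ℝ), ray v.bwd) v.vec ≠ 0 := fun h => by
    have := v.mink_bwd_vec
    rw [h] at this
    norm_num at this
  have c1 : Continuous fun z : EuclideanSpace ℝ (Fin (n + 1)) × EuclideanSpace ℝ (Fin (n + 1)) =>
    ((1 : ℝ), z.1) := by fun_prop
  have c2 : Continuous fun z : EuclideanSpace ℝ (Fin (n + 1)) × EuclideanSpace ℝ (Fin (n + 1)) =>
    ((1 : ℝ), z.2) := by fun_prop
  have d1 := ((continuous_mink_left v.vec).comp c1).continuousAt (x := (ray v.bwd, ray v.fwd))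
  have d2 := ((continuous_mink_left v.vec).comp c2).continuousAt (x := (ray v.bwd, ray v.fwd))
  exact (((d2.inv₀ h1).smul c2.continuousAt).sub ((d1.inv₀ h2).smul c1.continuousAt)).const_smul
    (1 / 2 : ℝ)

lemma footPoint_endVec_normalLine (hS : IsHypersurface ι) (hV : IsUnitNormalField ι V) (q : S) :
    footPoint (V q) (endVec (normalLine hS hV q)) = ι q := by
  rw [endVec_normalLine]; exact (normalVector hS hV q).footPoint_ray

/-- The normal map of an embedded hypersurface whose unit normal field is constant in Minkowski
space is a topological embedding. -/
lemma isEmbedding_normalLine [IsManifold (𝓡 n) ∞ S] (hS : IsHypersurface ι)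
    (hV : IsUnitNormalField ι V) (hι : Topology.IsEmbedding ι) (hconst : ∀ p q, V p = V q) :
    Topology.IsEmbedding (normalLine hS hV) := by
  -- Constancy of `V` lets one map, with `V q` fixed, recover every point of `S`.
  have hfoot : ∀ q, footPoint (V q) ∘ endVec ∘ normalLine hS hV = ι := fun q => by
    funext p
    rw [Function.comp_apply, Function.comp_apply, hconst q p, footPoint_endVec_normalLine]
  refine ⟨Topology.isInducing_iff_nhds.2 fun q => le_antisymm
    ((contMDiff_normalLine hS hV).continuous.tendsto q).le_comap ?_, fun p q h => ?_⟩
  · have hc : ContinuousAt (footPoint (V q) ∘ endVec) (normalLine hS hV q) := by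
      refine ContinuousAt.comp ?_ continuous_endVec.continuousAt
      rw [endVec_normalLine]
      exact (normalVector hS hV q).continuousAt_footPoint
    -- Neighbourhoods pulled back along `φ` are at least as fine as those pulled back along `ι`,
    -- which are the neighbourhoods of `q`.
    have hle := Filter.comap_mono (m := normalLine hS hV) hc.tendsto.le_comap
    rw [Filter.comap_comap, Function.comp_assoc, hfoot q, Function.comp_apply,
      footPoint_endVec_normalLine, ← hι.isInducing.nhds_eq_comap] at hle
    exact hle
  · apply hι.injective
    rw [← footPoint_endVec_normalLine hS hV p, ← footPoint_endVec_normalLine hS hV q, h,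
      hconst p q]

end NormalLine

end HypLines

/-! ### The theorem -/

open HypLines
theorem mainTheorem4 {n : ℕ} {S : Type*} [TopologicalSpace S]
    [ChartedSpace (EuclideanSpace ℝ (Fin n)) S] [IsManifold (𝓡 n) ∞ S] [ConnectedSpace S]
    (ι V : S → Mink n) (hS : IsHypersurface ι) (hcomplete : IsCompleteHypersurface ι)
    (hgeodesic : IsTotallyGeodesic ι) (hV : IsUnitNormalField ι V) :
    -- the map `φ` is a smooth embedding
    ContMDiff (𝓡 n) (lineModel n) ∞ (normalLine hS hV) ∧
    (∀ q, Function.Injective (mfderiv (𝓡 n) (lineModel n) (normalLine hS hV) q)) ∧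
    Topology.IsEmbedding (normalLine hS hV) ∧
    -- the induced metric is positive definite
    (∀ (q : S) (w : TangentSpace (𝓡 n) q), w ≠ 0 →
      0 < sqNorm ⟨normalLine hS hV q, mfderiv (𝓡 n) (lineModel n) (normalLine hS hV) q w⟩) ∧
    -- the induced norm is the norm of `S`
    (∀ (q : S) (w : TangentSpace (𝓡 n) q),
      sqNorm ⟨normalLine hS hV q, mfderiv (𝓡 n) (lineModel n) (normalLine hS hV) q w⟩ =
        inducedSqNorm ι q w) := by
  have hnorm : ∀ (q : S) (w : TangentSpace (𝓡 n) q),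
      sqNorm ⟨normalLine hS hV q, mfderiv (𝓡 n) (lineModel n) (normalLine hS hV) q w⟩ =
        inducedSqNorm ι q w := fun q w =>
    sqNorm_normalLine hS hV (coordDeriv_normal_eq_zero hS hgeodesic hV q) w
  have hpos : ∀ (q : S) (w : TangentSpace (𝓡 n) q), w ≠ 0 →
      0 < sqNorm ⟨normalLine hS hV q, mfderiv (𝓡 n) (lineModel n) (normalLine hS hV) q w⟩ :=
    fun q w hw => by rw [hnorm]; exact inducedSqNorm_pos hS hw
  refine ⟨contMDiff_normalLine hS hV, fun q => ?_, isEmbedding_normalLine hS hV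
    (isEmbedding_inclusion hS hgeodesic hV) (normal_eq hS hgeodesic hV), hpos, hnorm⟩
  -- A nonzero kernel vector would have square norm both zero and positive.
  refine (injective_iff_map_eq_zero _).2 fun w hw => ?_
  by_contra hne
  have h := hpos q w hne
  rw [hw, sqNorm_zero] at h
  exact h.false
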